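/- Let $n\ge 0$ and let $S$ be $n$-dimensional Euclidean space or $n$-dimensional hyperbolic space, with its distance $d_S$ and a distinguished origin $\mathcal O$. Let $G$ be the group of orientation-preserving isometries of $S$, with the topology of pointwise convergence. A body is a nonempty connected compact set $K\subset S$ that equals the closure of its interior. Put $\Sigma_K=\{g\in G : gK=K\}$. A packing by $K$ is a (possibly empty) collection $\mathcal P$ of sets $gK$, $g\in G$, with pairwise disjoint interiors; put $\hat{\mathcal P}=\{g\Sigma_K : gK\in\mathcal P\}\subset G/\Sigma_K$ and $c(\mathcal P)=\bigcup_{A\in\mathcal P}A$. Let $C_K$ be the set of all packings by $K$, on which $G$ acts by $h\mathcal P=\{hA : A\in\mathcal P\}$. Let $d_G$ be any left-invariant distance function on $G$ that induces the topology of $G$ and satisfies $d_S(p,q)=\inf\{d_G(g,h) : g\mathcal O=p,\ h\mathcal O=q\}$ for all $p,q\in S$. For $x,y\in G/\Sigma_K$ let $d^K(x,y)=\inf\{d_G(g,h) : g\Sigma_K=x,\ h\Sigma_K=y\}$; let $B^K_m=\{x : d^K(\Sigma_K,x)\le m\}$, and let $N_\varepsilon(X)$ be the set of all $y$ with $d^K(x,y)<\varepsilon$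 for some $x\in X$. For $m=1,2,\dots$ let $$d_m(\mathcal P,\mathcal Q)=\inf\{\varepsilon>0 : B^K_m\cap\hat{\mathcal P}\subset N_\varepsilon(\hat{\mathcal Q})\text{ and }B^K_m\cap\hat{\mathcal Q}\subset N_\varepsilon(\hat{\mathcal P})\}\in[0,\infty],$$ $$d_K(\mathcal P,\mathcal Q)=\sup_{m\ge1}\min\{d_m(\mathcal P,\mathcal Q)/m,\ 1/m\}.$$ Give $C_K$ the topology induced by $d_K$: a set $U\subset C_K$ is open if for every $\mathcal P\in U$ there is $\varepsilon>0$ such that every $\mathcal Q$ with $d_K(\mathcal P,\mathcal Q)<\varepsilon$ lies in $U$. Let $M_I(K)$ be the set of Borel probability measures $\mu$ on $C_K$ such that $\mu(gE)=\mu(E)$ for all $g\in G$ and all Borel sets $E\subset C_K$. For $\mu\in M_I(K)$ let $D(\mu)=\mu(\{\mathcal P\in C_K : \mathcal O\in c(\mathcal P)\})$, and let $D(K)=\sup_{\mu\in M_I(K)}D(\mu)$. A measure $\mu\in M_I(K)$ is ergodic if $\mu(E)\in\{0,1\}$ for every Borel set $E\subset C_K$ with $gE=E$ for all $g\in G$,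 and it is optimally dense for $K$ if it is ergodic and $D(\mu)=D(K)$. Theorem. For every body $K\subset S$ there exists an optimally dense measure for $K$. -/

import Mathlib

open Set Filter Topology MeasureTheory
open scoped ENNReal Pointwise

noncomputable section

/-- A linear map of determinant `1` has a left inverse of determinant `1`. -/
theorem exists_leftInverse_det_one {V : Type*} [AddCommGroup V] [Module ℝ V]
    [FiniteDimensional ℝ V] (A : V →ₗ[ℝ] V) (hA : LinearMap.det A = 1) :
    ∃ B : V →ₗ[ℝ] V, LinearMap.det B = 1 ∧ ∀ x, B (A x) = x := by
  have hu : IsUnit (LinearMap.det A) := by rw [hA]; exact isUnit_one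
  have he : ∀ x, (LinearMap.equivOfIsUnitDet hu).symm (A x) = x := fun x => by
    rw [LinearEquiv.symm_apply_eq, LinearMap.equivOfIsUnitDet_apply]
  have hc : (LinearMap.equivOfIsUnitDet hu).symm.toLinearMap ∘ₗ A = LinearMap.id :=
    LinearMap.ext he
  have hd := congrArg LinearMap.det hc
  rw [LinearMap.det_comp, hA, mul_one, LinearMap.det_id] at hd
  exact ⟨_, hd, he⟩

/-! ### Euclidean motions -/

/-- The group of orientation-preserving isometries of `n`-dimensional Euclidean space: the
isometries `x ↦ A x + b` whose linear part `A` has determinant `1`. -/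
def euclideanMotions (n : ℕ) :
    Subgroup (EuclideanSpace ℝ (Fin n) ≃ᵢ EuclideanSpace ℝ (Fin n)) where
  carrier := {g | ∃ (A : EuclideanSpace ℝ (Fin n) →ₗ[ℝ] EuclideanSpace ℝ (Fin n))
    (b : EuclideanSpace ℝ (Fin n)), LinearMap.det A = 1 ∧ ∀ x, g x = A x + b}
  mul_mem' := by
    rintro g h ⟨A, b, hA, hg⟩ ⟨B, c, hB, hh⟩
    refine ⟨A ∘ₗ B, A c + b, ?_, fun x => ?_⟩
    · rw [LinearMap.det_comp, hA, hB, one_mul]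
    · rw [IsometryEquiv.mul_apply, hh, hg, map_add, LinearMap.comp_apply, add_assoc]
  one_mem' := ⟨LinearMap.id, 0, LinearMap.det_id, fun x => by simp⟩
  inv_mem' := by
    rintro g ⟨A, b, hA, hg⟩
    obtain ⟨B, hB, hBA⟩ := exists_leftInverse_det_one A hA
    refine ⟨B, - B b, hB, fun x => ?_⟩
    have h1 : A (g⁻¹ x) = x - b := by
      rw [eq_sub_iff_add_eq, ← hg, IsometryEquiv.apply_inv_self]
    rw [← hBA (g⁻¹ x), h1, map_sub, sub_eq_add_neg]

/-! ### Hyperbolic space, in the hyperboloid model -/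

/-- The upper sheet `{(t, x) ∈ ℝ × ℝⁿ | t² = 1 + ‖x‖², t > 0}` of the unit hyperboloid. -/
@[ext]
structure HyperbolicSpace (n : ℕ) where
  time : ℝ
  space : EuclideanSpace ℝ (Fin n)
  time_pos : 0 < time
  time_sq : time ^ 2 = 1 + ‖space‖ ^ 2

namespace HyperbolicSpace

variable {n : ℕ}

/-- The point of the hyperboloid as a vector of the ambient Minkowski space. -/
def toVec (p : HyperbolicSpace n) : ℝ × EuclideanSpace ℝ (Fin n) := (p.time, p.space)

/-- The Lorentz product of two points of the hyperboloid, with the sign for which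
it is positive. -/
def lorentz (p q : HyperbolicSpace n) : ℝ := p.time * q.time - inner ℝ p.space q.space

/-- The base point `(1, 0)`. -/
def origin (n : ℕ) : HyperbolicSpace n := ⟨1, 0, one_pos, by simp⟩

theorem lorentz_comm (p q : HyperbolicSpace n) : lorentz p q = lorentz q p := by
  unfold lorentz
  rw [mul_comm, real_inner_comm]

theorem lorentz_self (p : HyperbolicSpace n) : lorentz p p = 1 := by
  unfold lorentz
  rw [real_inner_self_eq_norm_sq]
  linarith [p.time_sq]

theorem one_le_lorentz (p q : HyperbolicSpace n) : 1 ≤ lorentz p q := by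
  have h := real_inner_le_norm p.space q.space
  have hp := p.time_sq
  have hq := q.time_sq
  have h0 := mul_nonneg (norm_nonneg p.space) (norm_nonneg q.space)
  have hpq := mul_pos p.time_pos q.time_pos
  have : 1 + ‖p.space‖ * ‖q.space‖ ≤ p.time * q.time := by
    refine (sq_le_sq₀ (by linarith) hpq.le).1 ?_
    have e : (p.time * q.time) ^ 2 = (1 + ‖p.space‖ ^ 2) * (1 + ‖q.space‖ ^ 2) := by
      rw [mul_pow, hp, hq]
    nlinarith [sq_nonneg (‖p.space‖ - ‖q.space‖)]
  unfold lorentz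
  linarith

theorem eq_of_lorentz_eq_one {p q : HyperbolicSpace n} (h : lorentz p q = 1) : p = q := by
  have hp := p.time_sq
  have hq := q.time_sq
  have hi := abs_le.1 (abs_real_inner_le_norm p.space q.space)
  have e : (p.time * q.time) ^ 2 = (1 + ‖p.space‖ ^ 2) * (1 + ‖q.space‖ ^ 2) := by
    rw [mul_pow, hp, hq]
  have e2 : p.time * q.time = 1 + inner ℝ p.space q.space := by
    unfold lorentz at h
    linarith
  rw [e2] at e
  have hs : ‖p.space - q.space‖ ^ 2 ≤ 0 := by
    rw [norm_sub_sq_real]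
    nlinarith [sq_nonneg (‖p.space‖ * ‖q.space‖ - inner ℝ p.space q.space)]
  have hs' : p.space = q.space := by
    have : ‖p.space - q.space‖ = 0 := by
      nlinarith [norm_nonneg (p.space - q.space)]
    exact sub_eq_zero.1 (norm_eq_zero.1 this)
  refine HyperbolicSpace.ext ?_ hs'
  rw [hs', ← hq] at hp
  exact (sq_eq_sq₀ p.time_pos.le q.time_pos.le).1 hp

/-- The component of a vector orthogonal to a point of the hyperboloid is spacelike. -/
theorem spacelike_nonneg (y : HyperbolicSpace n) (a : ℝ) (v : EuclideanSpace ℝ (Fin n)) :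
    0 ≤ (inner ℝ v y.space - a * y.time) ^ 2 + ‖v‖ ^ 2 - a ^ 2 := by
  have hy := y.time_sq
  have hc := abs_real_inner_le_norm v y.space
  rcases (norm_nonneg y.space).eq_or_lt with h0 | h0
  · rw [← h0, mul_zero] at hc
    have hc0 : inner ℝ v y.space = 0 := abs_nonpos_iff.1 hc
    rw [← h0] at hy
    rw [hc0]
    nlinarith [sq_nonneg ‖v‖]
  · have hc2 : inner ℝ v y.space ^ 2 ≤ ‖v‖ ^ 2 * ‖y.space‖ ^ 2 := by
      rw [← mul_pow, ← sq_abs]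
      exact pow_le_pow_left₀ (abs_nonneg _) hc 2
    generalize (inner ℝ v y.space : ℝ) = c at *
    have key : 0 ≤ ((c - a * y.time) ^ 2 + ‖v‖ ^ 2 - a ^ 2) * ‖y.space‖ ^ 2 := by
      have e : ((c - a * y.time) ^ 2 + ‖v‖ ^ 2 - a ^ 2) * ‖y.space‖ ^ 2
          = (a * ‖y.space‖ ^ 2 - c * y.time) ^ 2 + (‖v‖ ^ 2 * ‖y.space‖ ^ 2 - c ^ 2) := by
        linear_combination (a ^ 2 * ‖y.space‖ ^ 2 - c ^ 2) * hy
      rw [e]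
      nlinarith [sq_nonneg (a * ‖y.space‖ ^ 2 - c * y.time)]
    exact nonneg_of_mul_nonneg_left key (by positivity)

theorem lorentz_gram (x y z : HyperbolicSpace n) :
    (lorentz x z - lorentz x y * lorentz y z) ^ 2
      ≤ (lorentz x y ^ 2 - 1) * (lorentz y z ^ 2 - 1) := by
  have h : ∀ t : ℝ, 0 ≤ (lorentz y z ^ 2 - 1) * (t * t)
      + (2 * (lorentz x y * lorentz y z - lorentz x z)) * t + (lorentz x y ^ 2 - 1) := by
    intro t
    have h1 := spacelike_nonneg y (x.time + t * z.time) (x.space + t • z.space)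
    have hx := x.time_sq
    have hz := z.time_sq
    rw [norm_add_sq_real, inner_add_left, real_inner_smul_left, real_inner_smul_right,
      norm_smul, mul_pow, Real.norm_eq_abs, sq_abs] at h1
    unfold lorentz
    rw [real_inner_comm y.space z.space] at *
    nlinarith
  have := discrim_le_zero h
  unfold discrim at this
  nlinarith

instance : Dist (HyperbolicSpace n) := ⟨fun p q => Real.arcosh (lorentz p q)⟩

theorem dist_def (p q : HyperbolicSpace n) : dist p q = Real.arcosh (lorentz p q) := rfl

theorem cosh_dist (p q : HyperbolicSpace n) : Real.cosh (dist p q) = lorentz p q :=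
  Real.cosh_arcosh (one_le_lorentz p q)

/-- Hyperbolic space with the hyperbolic distance, `cosh d(p, q) = p₀ q₀ - ⟨p, q⟩`. -/
instance : MetricSpace (HyperbolicSpace n) where
  dist_self p := by rw [dist_def, lorentz_self]; exact (Real.arcosh_eq_zero_iff le_rfl).2 rfl
  dist_comm p q := by rw [dist_def, dist_def, lorentz_comm]
  dist_triangle x y z := by
    have hxy := one_le_lorentz x y
    have hyz := one_le_lorentz y z
    have h1 := Real.arcosh_nonneg hxy
    have h2 := Real.arcosh_nonneg hyz
    rw [dist_def, dist_def, dist_def,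
      ← abs_of_nonneg (Real.arcosh_nonneg (one_le_lorentz x z)),
      ← abs_of_nonneg (add_nonneg h1 h2)]
    refine Real.cosh_le_cosh.1 ?_
    rw [Real.cosh_arcosh (one_le_lorentz x z), Real.cosh_add, Real.cosh_arcosh hxy,
      Real.cosh_arcosh hyz, Real.sinh_arcosh hxy, Real.sinh_arcosh hyz,
      ← Real.sqrt_mul (by nlinarith)]
    have := Real.le_sqrt_of_sq_le (lorentz_gram x y z)
    linarith
  eq_of_dist_eq_zero {p q} h :=
    eq_of_lorentz_eq_one ((Real.arcosh_eq_zero_iff (one_le_lorentz p q)).1 h)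

end HyperbolicSpace

/-- The group of orientation-preserving isometries of `n`-dimensional hyperbolic space: the
isometries of the hyperboloid that are induced by a linear map of determinant `1` of the
ambient Minkowski space. -/
def hyperbolicMotions (n : ℕ) : Subgroup (HyperbolicSpace n ≃ᵢ HyperbolicSpace n) where
  carrier := {g | ∃ A : (ℝ × EuclideanSpace ℝ (Fin n)) →ₗ[ℝ] (ℝ × EuclideanSpace ℝ (Fin n)),
    LinearMap.det A = 1 ∧ ∀ p, (g p).toVec = A p.toVec}
  mul_mem' := by
    rintro g h ⟨A, hA, hg⟩ ⟨B, hB, hh⟩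
    refine ⟨A ∘ₗ B, ?_, fun p => ?_⟩
    · rw [LinearMap.det_comp, hA, hB, one_mul]
    · rw [IsometryEquiv.mul_apply, hg, hh, LinearMap.comp_apply]
  one_mem' := ⟨LinearMap.id, LinearMap.det_id, fun _ => rfl⟩
  inv_mem' := by
    rintro g ⟨A, hA, hg⟩
    obtain ⟨B, hB, hBA⟩ := exists_leftInverse_det_one A hA
    refine ⟨B, hB, fun p => ?_⟩
    rw [← hBA (g⁻¹ p).toVec, ← hg, IsometryEquiv.apply_inv_self]

/-! ### Bodies, motions and packings -/

section Packing

variable {S : Type*} [MetricSpace S]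

/-- A body: a nonempty connected compact set that is the closure of its interior. -/
structure IsBody (K : Set S) : Prop where
  isConnected : IsConnected K
  isCompact : IsCompact K
  closure_interior : closure (interior K) = K

/-- A left-invariant distance function `d_G` on the group `G` of motions of `S` that induces the
topology of `G` (the topology of pointwise convergence on `S`) and such that the distance of two
points of `S` is the infimum of the `d_G`-distances of their lifts under `g ↦ g O`. -/
structure InvariantDist (G : Subgroup (S ≃ᵢ S)) (O : S) where
  d : G → G → ℝ
  eq_zero_iff : ∀ g h, d g h = 0 ↔ g = h
  comm : ∀ g h, d g h = d h g
  triangle : ∀ g h k, d g k ≤ d g h + d h k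
  left_inv : ∀ k g h, d (k * g) (k * h) = d g h
  tendsto_iff : ∀ (u : ℕ → G) (g : G),
    Tendsto (fun i => d (u i) g) atTop (𝓝 0) ↔
      ∀ p : S, Tendsto (fun i => (u i : S ≃ᵢ S) p) atTop (𝓝 ((g : S ≃ᵢ S) p))
  isGLB_lifts : ∀ p q : S,
    IsGLB {r | ∃ g h : G, (g : S ≃ᵢ S) O = p ∧ (h : S ≃ᵢ S) O = q ∧ d g h = r} (dist p q)

variable {G : Subgroup (S ≃ᵢ S)} {O : S}

/-- The symmetry group `Σ_K = {g ∈ G | g K = K}` of `K`. -/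
def symmetryGroup (G : Subgroup (S ≃ᵢ S)) (K : Set S) : Subgroup G where
  carrier := {g | (g : S ≃ᵢ S) '' K = K}
  mul_mem' := by
    intro g h hg hh
    change ((g * h : G) : S ≃ᵢ S) '' K = K
    rw [Subgroup.coe_mul, IsometryEquiv.coe_mul, image_comp]
    rw [mem_ofPred_eq] at hg hh
    rw [hh, hg]
  one_mem' := by simp
  inv_mem' := by
    intro g hg
    change ((g⁻¹ : G) : S ≃ᵢ S) '' K = K
    rw [mem_ofPred_eq] at hg
    nth_rewrite 1 [← hg]
    rw [← image_comp, Subgroup.coe_inv, ← IsometryEquiv.coe_mul, inv_mul_cancel]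
    simp

/-- The pushforward `d^K` of `d_G` to the coset space `G / Σ_K`. -/
def cosetDist (δ : InvariantDist G O) (K : Set S) (x y : G ⧸ symmetryGroup G K) : ℝ :=
  sInf {r | ∃ g h : G, (g : G ⧸ symmetryGroup G K) = x ∧ (h : G ⧸ symmetryGroup G K) = y ∧
    δ.d g h = r}

/-- The space `C_K` of packings by `K`: the collections of congruent copies `g K`, `g ∈ G`, with
pairwise disjoint interiors. The parameter `δ` is used for the topology only. -/
@[ext]
structure PackingSpace (δ : InvariantDist G O) (K : Set S) where
  bodies : Set (Set S)
  congruent : ∀ A ∈ bodies, ∃ g : G, A = (g : S ≃ᵢ S) '' K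
  disjoint : ∀ A ∈ bodies, ∀ B ∈ bodies, A ≠ B → Disjoint (interior A) (interior B)

namespace PackingSpace

variable {δ : InvariantDist G O} {K : Set S}

/-- The set of cosets `g Σ_K` with `g K` in the packing. -/
def cosets (P : PackingSpace δ K) : Set (G ⧸ symmetryGroup G K) :=
  {x | ∃ g : G, (g : G ⧸ symmetryGroup G K) = x ∧ (g : S ≃ᵢ S) '' K ∈ P.bodies}

/-- The closed set `c(P)` covered by the packing. -/
def covered (P : PackingSpace δ K) : Set S := ⋃₀ P.bodies

/-- The closed ball `B^K_r` of radius `r` about `Σ_K` in `G / Σ_K`. -/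
def cosetBall (δ : InvariantDist G O) (K : Set S) (r : ℝ) : Set (G ⧸ symmetryGroup G K) :=
  {x | cosetDist δ K ((1 : G) : G ⧸ symmetryGroup G K) x ≤ r}

/-- The open `ε`-neighbourhood of a subset of `G / Σ_K`. -/
def cosetNhd (δ : InvariantDist G O) (K : Set S) (ε : ℝ) (X : Set (G ⧸ symmetryGroup G K)) :
    Set (G ⧸ symmetryGroup G K) :=
  {y | ∃ x ∈ X, cosetDist δ K x y < ε}

/-- `d_n(P, Q)`, with value `∞` if no `ε` is admissible. -/
def windowDist (n : ℕ) (P Q : PackingSpace δ K) : ℝ≥0∞ :=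
  sInf {e | ∃ ε : ℝ, 0 < ε ∧ cosetBall δ K n ∩ P.cosets ⊆ cosetNhd δ K ε Q.cosets ∧
    cosetBall δ K n ∩ Q.cosets ⊆ cosetNhd δ K ε P.cosets ∧ e = ENNReal.ofReal ε}

/-- `d_K(P, Q) = sup_{n ≥ 1} min (d_n(P, Q) / n) (1 / n)`. -/
def packingDist (P Q : PackingSpace δ K) : ℝ≥0∞ :=
  ⨆ n : ℕ, ⨆ _ : 1 ≤ n, min (windowDist n P Q / n) (1 / n)

/-- The topology induced by `d_K`: a set is open if it contains a `d_K`-ball about each of its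
points. -/
instance : TopologicalSpace (PackingSpace δ K) where
  IsOpen U := ∀ P ∈ U, ∃ ε : ℝ≥0∞, 0 < ε ∧ ∀ Q, packingDist P Q < ε → Q ∈ U
  isOpen_univ := fun _ _ => ⟨1, one_pos, fun _ _ => mem_univ _⟩
  isOpen_inter := by
    rintro U V hU hV P ⟨h1, h2⟩
    obtain ⟨a, ha, h⟩ := hU P h1
    obtain ⟨b, hb, h'⟩ := hV P h2
    exact ⟨min a b, lt_min ha hb, fun Q hQ =>
      ⟨h Q (hQ.trans_le (min_le_left _ _)), h' Q (hQ.trans_le (min_le_right _ _))⟩⟩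
  isOpen_sUnion := by
    rintro F hF P ⟨U, hU, hP⟩
    obtain ⟨a, ha, h⟩ := hF U hU P hP
    exact ⟨a, ha, fun Q hQ => ⟨U, hU, h Q hQ⟩⟩

instance : MeasurableSpace (PackingSpace δ K) := borel _

instance : BorelSpace (PackingSpace δ K) := ⟨rfl⟩

/-- The action of the motions on packings, `h P = {h A | A ∈ P}`. -/
instance : SMul G (PackingSpace δ K) where
  smul h P :=
    { bodies := (fun A => (h : S ≃ᵢ S) '' A) '' P.bodies
      congruent := by
        rintro _ ⟨A, hA, rfl⟩
        obtain ⟨g, rfl⟩ := P.congruent A hA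
        refine ⟨h * g, ?_⟩
        rw [Subgroup.coe_mul, IsometryEquiv.coe_mul, image_comp]
      disjoint := by
        rintro _ ⟨A, hA, rfl⟩ _ ⟨B, hB, rfl⟩ hne
        have hAB : A ≠ B := fun e => hne (by rw [e])
        have hi : ∀ C : Set S, interior ((h : S ≃ᵢ S) '' C) = (h : S ≃ᵢ S) '' interior C :=
          fun C => ((h : S ≃ᵢ S).toHomeomorph.image_interior C).symm
        change Disjoint (interior ((h : S ≃ᵢ S) '' A)) (interior ((h : S ≃ᵢ S) '' B))
        rw [hi, hi]
        exact (disjoint_image_iff (h : S ≃ᵢ S).injective).2 (P.disjoint A hA B hB hAB) }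

/-- `μ` belongs to `M_I`: it is a Borel probability measure with `μ(g E) = μ(E)` for every motion
`g` and every Borel set `E`. -/
structure IsInvariantProbability (μ : Measure (PackingSpace δ K)) : Prop where
  isProbabilityMeasure : IsProbabilityMeasure μ
  invariant : ∀ (g : G) (E : Set (PackingSpace δ K)), MeasurableSet E → μ (g • E) = μ E

/-- The density `D(μ)`: the probability that the origin is covered. -/
def density (μ : Measure (PackingSpace δ K)) : ℝ≥0∞ :=
  μ {P | O ∈ P.covered}

/-- The optimal density `D(K)`, the supremum of `D(μ)` over all `μ` in `M_I`. -/
def optimalDensity (δ : InvariantDist G O) (K : Set S) : ℝ≥0∞ :=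
  sSup {t | ∃ μ : Measure (PackingSpace δ K), IsInvariantProbability μ ∧ density μ = t}

/-- Ergodicity: a Borel set `E` with `g E = E` for all motions `g` has measure `0` or `1`. -/
def IsErgodic (μ : Measure (PackingSpace δ K)) : Prop :=
  ∀ E : Set (PackingSpace δ K), MeasurableSet E → (∀ g : G, g • E = E) → μ E = 0 ∨ μ E = 1

/-- `μ` is optimally dense for `K`. -/
structure IsOptimallyDense (μ : Measure (PackingSpace δ K)) : Prop where
  isInvariantProbability : IsInvariantProbability μ
  isErgodic : IsErgodic μ
  density_eq : density μ = optimalDensity δ K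

end PackingSpace

end Packing

end

/-!
An optimally dense measure is an extreme point of a compact convex set. Invariant measures exist
(the point mass at the empty packing is one), and if the packing space is compact and metrizable,
the group acts on it by homeomorphisms, and the packings covering the origin form a closed set, then
the invariant probability measures form a weakly compact convex set on which the density is affine
and upper semicontinuous. The density is therefore maximal on a nonempty compact face.
Maximizing successively the integrals of a dense sequence of continuous functions shrinks this face
to a single measure, which must be ergodic: conditioning on an invariant set of intermediate measure
would exhibit it as a mixture of two other measures of the face
(`exists_ergodic_maximizing`).

What remains is topology, and it works for any group `G` of isometries of a proper metric space that
is closed under pointwise limits. A sequence in `G` that moves the base point by a bounded amount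
has a convergent subsequence in `G` (`IsPointwiseClosed.exists_subseq_tendsto`). The quantity
`cosetDist` need not satisfy the triangle inequality, because the distance on `G` is not assumed
right invariant under the symmetries of `K`. It is, however, uniformly comparable with the Hausdorff
distance between the copies of `K`, by compactness, and so `packingDist` induces the topology of a
countably generated uniform structure: two packings are close if, on a large ball, each body of one
is Hausdorff close to a body of the other (`topology_eq_uniformCore`). An ultrafilter of packings
converges to the packing of all copies of `K` that are approximated by almost all its members
(`ultrafilter_le_nhds_limit`), which gives compactness. The interior of `K` is nonempty, so two
copies close to a third one overlap; this makes the limit a packing, and makes the bodies of a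
packing a closed set, from which the Hausdorff property and the closedness of the covering event
follow.

Euclidean and hyperbolic space are proper, and their motion groups are closed because the
determinant is continuous.
-/

open Set Filter Topology MeasureTheory
open scoped ENNReal Pointwise

noncomputable section

/-! ### Ergodic measures of maximal mass on a closed set -/

section Maximizers

variable {Y : Type*}

/-- The points of `s` at which `Φ` attains its maximum over `s`. -/
def maximizers (Φ : Y → ℝ) (s : Set Y) : Set Y := {y ∈ s | ∀ z ∈ s, Φ z ≤ Φ y}

theorem maximizers_subset (Φ : Y → ℝ) (s : Set Y) : maximizers Φ s ⊆ s := fun _ h => h.1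

theorem maximizers_nonempty [TopologicalSpace Y] {Φ : Y → ℝ}
    (hΦ : UpperSemicontinuous Φ) {s : Set Y}
    (hs : IsCompact s) (hne : s.Nonempty) : (maximizers Φ s).Nonempty := by
  obtain ⟨a, ha, hmax⟩ := (hΦ.upperSemicontinuousOn s).exists_isMaxOn hne hs
  exact ⟨a, ha, fun z hz => hmax hz⟩

theorem isClosed_maximizers [TopologicalSpace Y] {Φ : Y → ℝ}
    (hΦ : UpperSemicontinuous Φ) {s : Set Y}
    (hs : IsClosed s) : IsClosed (maximizers Φ s) := by
  have : maximizers Φ s = s ∩ ⋂ z ∈ s, Φ ⁻¹' Ici (Φ z) := by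
    ext y; simp [maximizers]
  rw [this]
  exact hs.inter (isClosed_biInter fun z _ =>
    upperSemicontinuous_iff_isClosed_preimage.1 hΦ (Φ z))

end Maximizers

section Faces

variable {X : Type*} [MeasurableSpace X]

/-- `μ` is the proper convex combination `p μ₁ + q μ₂`. -/
structure IsMixture (p q : ℝ≥0∞) (μ μ₁ μ₂ : ProbabilityMeasure X) : Prop where
  left_ne_zero : p ≠ 0
  right_ne_zero : q ≠ 0
  sum_eq_one : p + q = 1
  eq : (μ : Measure X) = p • (μ₁ : Measure X) + q • (μ₂ : Measure X)

namespace IsMixture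

variable {p q : ℝ≥0∞} {μ μ₁ μ₂ : ProbabilityMeasure X}

theorem left_ne_top (h : IsMixture p q μ μ₁ μ₂) : p ≠ ∞ := by
  rintro rfl
  simpa using h.sum_eq_one

theorem right_ne_top (h : IsMixture p q μ μ₁ μ₂) : q ≠ ∞ := by
  rintro rfl
  simpa using h.sum_eq_one

theorem toReal_add (h : IsMixture p q μ μ₁ μ₂) : p.toReal + q.toReal = 1 := by
  rw [← ENNReal.toReal_add h.left_ne_top h.right_ne_top, h.sum_eq_one, ENNReal.toReal_one]

theorem real_eq (h : IsMixture p q μ μ₁ μ₂) (F : Set X) : (μ : Measure X).real F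
    = p.toReal * (μ₁ : Measure X).real F + q.toReal * (μ₂ : Measure X).real F := by
  have h1 := h.left_ne_top
  have h2 := h.right_ne_top
  rw [h.eq, Measure.real, Measure.add_apply, Measure.smul_apply, Measure.smul_apply,
    ENNReal.toReal_add, smul_eq_mul, smul_eq_mul, ENNReal.toReal_mul, ENNReal.toReal_mul,
    Measure.real, Measure.real]
  · exact ENNReal.mul_ne_top h1 (measure_ne_top _ _)
  · exact ENNReal.mul_ne_top h2 (measure_ne_top _ _)

theorem integral_eq (h : IsMixture p q μ μ₁ μ₂) {f : X → ℝ}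
    (h₁ : Integrable f (μ₁ : Measure X)) (h₂ : Integrable f (μ₂ : Measure X)) :
    ∫ x, f x ∂(μ : Measure X)
      = p.toReal * ∫ x, f x ∂(μ₁ : Measure X) + q.toReal * ∫ x, f x ∂(μ₂ : Measure X) := by
  rw [h.eq, integral_add_measure (h₁.smul_measure h.left_ne_top)
    (h₂.smul_measure h.right_ne_top), integral_smul_measure, integral_smul_measure,
    smul_eq_mul, smul_eq_mul]

end IsMixture

/-- `s` is a face of `I`: if a mixture of two elements of `I` lies in `s`, so do both. -/
def IsFace (I s : Set (ProbabilityMeasure X)) : Prop :=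
  ∀ p q μ μ₁ μ₂, IsMixture p q μ μ₁ μ₂ → μ₁ ∈ I → μ₂ ∈ I → μ ∈ s → μ₁ ∈ s ∧ μ₂ ∈ s

theorem IsFace.maximizers {I s : Set (ProbabilityMeasure X)} (hs : IsFace I s)
    {Φ : ProbabilityMeasure X → ℝ}
    (hΦ : ∀ p q μ μ₁ μ₂, IsMixture p q μ μ₁ μ₂ → Φ μ = p.toReal * Φ μ₁ + q.toReal * Φ μ₂) :
    IsFace I (maximizers Φ s) := by
  intro p q μ μ₁ μ₂ h h₁ h₂ hμ
  obtain ⟨m₁, m₂⟩ := hs p q μ μ₁ μ₂ h h₁ h₂ hμ.1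
  have e := hΦ p q μ μ₁ μ₂ h
  have hp := ENNReal.toReal_pos h.left_ne_zero h.left_ne_top
  have hq := ENNReal.toReal_pos h.right_ne_zero h.right_ne_top
  have hpq : p.toReal * Φ μ + q.toReal * Φ μ = Φ μ := by rw [← add_mul, h.toReal_add, one_mul]
  have l₁ := hμ.2 μ₁ m₁
  have l₂ := hμ.2 μ₂ m₂
  have e₁ : Φ μ₁ = Φ μ := by
    refine le_antisymm l₁ ?_
    by_contra! hlt
    nlinarith [mul_lt_mul_of_pos_left hlt hp, mul_le_mul_of_nonneg_left l₂ hq.le]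
  have e₂ : Φ μ₂ = Φ μ := by
    refine le_antisymm l₂ ?_
    by_contra! hlt
    nlinarith [mul_lt_mul_of_pos_left hlt hq, mul_le_mul_of_nonneg_left l₁ hp.le]
  exact ⟨⟨m₁, fun z hz => e₁ ▸ hμ.2 z hz⟩, ⟨m₂, fun z hz => e₂ ▸ hμ.2 z hz⟩⟩

end Faces

section Ergodic

variable {Γ X : Type*} [Group Γ] [MulAction Γ X] [MeasurableSpace X]

variable (Γ X) in
/-- The Borel probability measures on `X` that are invariant under the action of `Γ`. -/
def invariantMeasures : Set (ProbabilityMeasure X) :=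
  {μ | ∀ (g : Γ) (E : Set X), MeasurableSet E → (μ : Measure X) (g • E) = (μ : Measure X) E}

/-- The conditional measure of an invariant measure on an invariant set is invariant. -/
theorem cond_mem_invariantMeasures {μ : ProbabilityMeasure X} (hμ : μ ∈ invariantMeasures Γ X)
    {E : Set X} (hE : MeasurableSet E) (hinv : ∀ g : Γ, g • E = E)
    (hc : IsProbabilityMeasure (ProbabilityTheory.cond (μ : Measure X) E)) :
    (⟨ProbabilityTheory.cond (μ : Measure X) E, hc⟩ : ProbabilityMeasure X)
      ∈ invariantMeasures Γ X := by
  intro g A hA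
  change ProbabilityTheory.cond (μ : Measure X) E (g • A)
    = ProbabilityTheory.cond (μ : Measure X) E A
  rw [ProbabilityTheory.cond_apply hE, ProbabilityTheory.cond_apply hE]
  nth_rewrite 2 [← hinv g]
  rw [← smul_set_inter, hμ g _ (hE.inter hA)]

/-- A probability measure splits as the mixture of its conditional measures on a set and on its
complement. -/
theorem isMixture_cond (μ : ProbabilityMeasure X) {E : Set X} (hE : MeasurableSet E)
    (h0 : (μ : Measure X) E ≠ 0) (h1 : (μ : Measure X) Eᶜ ≠ 0)
    (hc : IsProbabilityMeasure (ProbabilityTheory.cond (μ : Measure X) E))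
    (hc' : IsProbabilityMeasure (ProbabilityTheory.cond (μ : Measure X) Eᶜ)) :
    IsMixture ((μ : Measure X) E) ((μ : Measure X) Eᶜ) μ
      ⟨ProbabilityTheory.cond (μ : Measure X) E, hc⟩
      ⟨ProbabilityTheory.cond (μ : Measure X) Eᶜ, hc'⟩ where
  left_ne_zero := h0
  right_ne_zero := h1
  sum_eq_one := prob_add_prob_compl hE
  eq := by
    ext A hA
    have := ProbabilityTheory.cond_add_cond_compl_eq hE (t := A) (μ := (μ : Measure X))
    rw [← this]
    simp [mul_comm]

variable [TopologicalSpace X] [BorelSpace X]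

theorem mem_invariantMeasures_iff_map [ContinuousConstSMul Γ X] {μ : ProbabilityMeasure X} :
    μ ∈ invariantMeasures Γ X ↔ ∀ g : Γ,
      μ.map (continuous_const_smul g : Continuous fun x : X => g • x).measurable.aemeasurable
        = μ := by
  have hm : ∀ g : Γ, Measurable fun x : X => g • x := fun g => (continuous_const_smul g).measurable
  constructor
  · intro h g
    refine ProbabilityMeasure.eq_of_forall_toMeasure_apply_eq _ _ fun E hE => ?_
    rw [ProbabilityMeasure.toMeasure_map, Measure.map_apply (hm g) hE, preimage_smul]
    exact h g⁻¹ E hE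
  · intro h g E hE
    have := congrArg (fun ν : ProbabilityMeasure X => (ν : Measure X) E) (h g⁻¹)
    simpa only [ProbabilityMeasure.toMeasure_map, Measure.map_apply (hm _) hE, preimage_smul,
      inv_inv] using this

theorem isClosed_invariantMeasures [ContinuousConstSMul Γ X] [HasOuterApproxClosed X] :
    IsClosed (invariantMeasures Γ X) := by
  have : invariantMeasures Γ X = ⋂ g : Γ, {μ | μ.map
      (continuous_const_smul g : Continuous fun x : X => g • x).measurable.aemeasurable = μ} := by
    ext μ
    rw [mem_invariantMeasures_iff_map, mem_iInter]
    rfl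
  rw [this]
  exact isClosed_iInter fun g =>
    isClosed_eq (ProbabilityMeasure.continuous_map (continuous_const_smul g)) continuous_id

theorem upperSemicontinuous_measureReal [HasOuterApproxClosed X] {F : Set X} (hF : IsClosed F) :
    UpperSemicontinuous fun μ : ProbabilityMeasure X => (μ : Measure X).real F := by
  have h : UpperSemicontinuous fun μ : ProbabilityMeasure X => (μ : Measure X) F :=
    upperSemicontinuous_iff_limsup_le.2 fun μ =>
      ProbabilityMeasure.limsup_measure_closed_le_of_tendsto tendsto_id hF
  intro μ t ht
  have h1 : (μ : Measure X) F < ENNReal.ofReal t :=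
    (ENNReal.lt_ofReal_iff_toReal_lt (measure_ne_top _ _)).2 ht
  filter_upwards [h μ _ h1] with ν hν
  exact (ENNReal.lt_ofReal_iff_toReal_lt (measure_ne_top _ _)).1 hν

variable [CompactSpace X] [TopologicalSpace.MetrizableSpace X] [ContinuousConstSMul Γ X]

/-- Maximize `μ F` over the invariant measures, and then successively the integrals of a dense
sequence of continuous functions: the only measure that survives is an extreme point of the set of
invariant measures, and extreme points are ergodic. -/
theorem exists_ergodic_maximizing {F : Set X} (hF : IsClosed F)
    (hne : (invariantMeasures Γ X).Nonempty) :
    ∃ μ ∈ invariantMeasures Γ X,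
      (∀ E : Set X, MeasurableSet E → (∀ g : Γ, g • E = E) →
        (μ : Measure X) E = 0 ∨ (μ : Measure X) E = 1) ∧
      ∀ ν ∈ invariantMeasures Γ X, (ν : Measure X) F ≤ (μ : Measure X) F := by
  classical
  have : SecondCountableTopology X := by
    let _ := TopologicalSpace.metrizableSpaceMetric X
    infer_instance
  set I := invariantMeasures Γ X with hI
  let f : ℕ → C(X, ℝ) := TopologicalSpace.denseSeq C(X, ℝ)
  let Φ : ℕ → ProbabilityMeasure X → ℝ := fun k μ => ∫ x, f k x ∂(μ : Measure X)
  have hint : ∀ (u : C(X, ℝ)) (μ : ProbabilityMeasure X), Integrable u (μ : Measure X) :=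
    fun u μ => u.continuous.integrable_of_hasCompactSupport (HasCompactSupport.of_compactSpace _)
  have hΦc : ∀ u : C(X, ℝ), Continuous fun μ : ProbabilityMeasure X =>
      ∫ x, u x ∂(μ : Measure X) := fun u =>
    ProbabilityMeasure.continuous_integral_boundedContinuousFunction
      (BoundedContinuousFunction.mkOfCompact u)
  let M : ℕ → Set (ProbabilityMeasure X) := fun k => Nat.rec
    (maximizers (fun μ : ProbabilityMeasure X => (μ : Measure X).real F) I)
    (fun k s => maximizers (Φ k) s) k
  have hM0 : M 0 = maximizers (fun μ : ProbabilityMeasure X => (μ : Measure X).real F) I := rfl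
  have hMs : ∀ k, M (k + 1) = maximizers (Φ k) (M k) := fun k => rfl
  have hIc : IsClosed I := isClosed_invariantMeasures
  have hMp : ∀ k, IsClosed (M k) ∧ (M k).Nonempty ∧ IsFace I (M k) := by
    intro k
    induction k with
    | zero =>
      refine ⟨isClosed_maximizers (upperSemicontinuous_measureReal hF) hIc,
        maximizers_nonempty (upperSemicontinuous_measureReal hF) hIc.isCompact hne,
        IsFace.maximizers (fun p q μ μ₁ μ₂ _ h₁ h₂ _ => ⟨h₁, h₂⟩) ?_⟩
      exact fun p q μ μ₁ μ₂ h => h.real_eq F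
    | succ k ih =>
      rw [hMs]
      exact ⟨isClosed_maximizers (hΦc (f k)).upperSemicontinuous ih.1,
        maximizers_nonempty (hΦc (f k)).upperSemicontinuous ih.1.isCompact ih.2.1,
        ih.2.2.maximizers fun p q μ μ₁ μ₂ h => h.integral_eq (hint _ _) (hint _ _)⟩
  obtain ⟨μ, hμ⟩ := IsCompact.nonempty_iInter_of_sequence_nonempty_isCompact_isClosed M
    (fun k => maximizers_subset _ _) (fun k => (hMp k).2.1) (hMp 0).1.isCompact
    (fun k => (hMp k).1)
  rw [mem_iInter] at hμ
  refine ⟨μ, (hμ 0).1, ?_, fun ν hν => ?_⟩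
  · intro E hE hinv
    by_contra! hcon
    obtain ⟨h0, h1⟩ := hcon
    have h1' : (μ : Measure X) Eᶜ ≠ 0 := by
      rwa [Ne, prob_compl_eq_zero_iff hE]
    have hc := ProbabilityTheory.cond_isProbabilityMeasure h0
    have hc' := ProbabilityTheory.cond_isProbabilityMeasure h1'
    have hinv' : ∀ g : Γ, g • Eᶜ = Eᶜ := fun g => by rw [smul_set_compl, hinv]
    have m₁ := cond_mem_invariantMeasures (hμ 0).1 hE hinv hc
    have m₂ := cond_mem_invariantMeasures (hμ 0).1 hE.compl hinv' hc'
    have hmix := isMixture_cond μ hE h0 h1' hc hc'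
    set ν : ProbabilityMeasure X := ⟨ProbabilityTheory.cond (μ : Measure X) E, hc⟩ with hν
    have hνM : ∀ k, ν ∈ M k := fun k => ((hMp k).2.2 _ _ _ _ _ hmix m₁ m₂ (hμ k)).1
    have heq : ∀ k, Φ k ν = Φ k μ := fun k => by
      have a := hμ (k + 1)
      have b := hνM (k + 1)
      rw [hMs] at a b
      exact le_antisymm (a.2 _ b.1) (b.2 _ a.1)
    have hall : ∀ u : C(X, ℝ), ∫ x, u x ∂(ν : Measure X) = ∫ x, u x ∂(μ : Measure X) := by
      have hcont : ∀ ρ : ProbabilityMeasure X,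
          Continuous fun u : C(X, ℝ) => ∫ x, u x ∂(ρ : Measure X) := fun ρ => by
        refine continuous_iff_continuousAt.2 fun u => ?_
        refine LipschitzWith.continuous (K := 1) (LipschitzWith.of_dist_le_mul fun u v => ?_)
          |>.continuousAt
        rw [dist_eq_norm, ← integral_sub (hint _ _) (hint _ _)]
        have := norm_integral_le_of_norm_le_const (μ := (ρ : Measure X))
          (f := fun x => u x - v x) (C := dist u v)
          (Eventually.of_forall fun x => by
            rw [← dist_eq_norm]; exact ContinuousMap.dist_apply_le_dist x)
        simpa using this
      have := Continuous.ext_on (TopologicalSpace.denseRange_denseSeq C(X, ℝ)) (hcont ν) (hcont μ)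
        (by rintro _ ⟨k, rfl⟩; exact heq k)
      exact fun u => congrFun this u
    have hνμ : (ν : Measure X) = (μ : Measure X) :=
      ext_of_forall_integral_eq_of_IsFiniteMeasure fun u => hall u.toContinuousMap
    apply h1
    rw [← hνμ, hν]
    exact ProbabilityTheory.cond_apply_self h0 (measure_ne_top _ _)
  · have := (hμ 0).2 ν hν
    exact (ENNReal.toReal_le_toReal (measure_ne_top _ _) (measure_ne_top _ _)).1 this

end Ergodic

/-! ### Compactness in groups of isometries -/

open TopologicalSpace (NonemptyCompacts)

section Isometries

variable {S : Type*} [MetricSpace S]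

/-- A sequence of isometries of a proper space that moves some point by a bounded amount has a
pointwise convergent subsequence. -/
theorem exists_subseq_tendsto_pointwise [ProperSpace S] (O : S) {r : ℝ} (u : ℕ → S ≃ᵢ S)
    (hu : ∀ i, dist O (u i O) ≤ r) :
    ∃ φ : ℕ → ℕ, StrictMono φ ∧ ∃ f : S → S,
      ∀ p, Tendsto (fun i => u (φ i) p) atTop (𝓝 (f p)) := by
  have : Nonempty S := ⟨O⟩
  let d : ℕ → S := TopologicalSpace.denseSeq S
  have hK : IsCompact (univ.pi fun j : ℕ => Metric.closedBall O (dist (d j) O + r)) :=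
    isCompact_univ_pi fun j => isCompact_closedBall _ _
  obtain ⟨a, -, φ, hφ, ha⟩ := hK.tendsto_subseq (x := fun i j => u i (d j)) fun i j _ => by
    rw [Metric.mem_closedBall]
    calc dist (u i (d j)) O ≤ dist (u i (d j)) (u i O) + dist (u i O) O := dist_triangle _ _ _
      _ ≤ dist (d j) O + r := by rw [(u i).dist_eq, dist_comm (u i O)]; gcongr; exact hu i
  rw [tendsto_pi_nhds] at ha
  have hc : ∀ p, ∃ q, Tendsto (fun i => u (φ i) p) atTop (𝓝 q) := fun p => by
    refine cauchySeq_tendsto_of_complete (Metric.cauchySeq_iff.2 fun ε hε => ?_)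
    obtain ⟨j, hj⟩ := Metric.denseRange_iff.1 (TopologicalSpace.denseRange_denseSeq S) p (ε / 3)
      (by positivity)
    obtain ⟨N, hN⟩ := Metric.cauchySeq_iff.1 (ha j).cauchySeq (ε / 3) (by positivity)
    refine ⟨N, fun m hm n hn => ?_⟩
    have h := hN m hm n hn
    have h4 := dist_triangle4 (u (φ m) p) (u (φ m) (d j)) (u (φ n) (d j)) (u (φ n) p)
    rw [(u (φ m)).dist_eq, (u (φ n)).dist_eq, dist_comm _ p] at h4
    simp only [Function.comp_apply] at h
    have : dist p (d j) < ε / 3 := hj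
    linarith
  choose f hf using hc
  exact ⟨φ, hφ, f, hf⟩

/-- The pointwise limit is again a bijection: its inverse is a limit of the inverses. -/
theorem exists_subseq_tendsto_isometryEquiv [ProperSpace S] (O : S) {r : ℝ} (u : ℕ → S ≃ᵢ S)
    (hu : ∀ i, dist O (u i O) ≤ r) :
    ∃ φ : ℕ → ℕ, StrictMono φ ∧ ∃ g : S ≃ᵢ S,
      ∀ p, Tendsto (fun i => u (φ i) p) atTop (𝓝 (g p)) := by
  obtain ⟨φ, hφ, f, hf⟩ := exists_subseq_tendsto_pointwise O u hu
  obtain ⟨ψ, hψ, f', hf'⟩ := exists_subseq_tendsto_pointwise O (fun i => (u (φ i)).symm)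
    (r := r) fun i => by
      rw [← (u (φ i)).dist_eq, IsometryEquiv.apply_symm_apply, dist_comm]
      exact hu _
  have hiso : Isometry f := Isometry.of_dist_eq fun x y =>
    tendsto_nhds_unique ((hf x).dist (hf y)) (by simp [(u _).dist_eq])
  refine ⟨φ ∘ ψ, hφ.comp hψ, IsometryEquiv.mk' f f' (fun x => ?_) hiso,
    fun p => (hf p).comp hψ.tendsto_atTop⟩
  refine tendsto_nhds_unique ((hf (f' x)).comp hψ.tendsto_atTop) ?_
  rw [tendsto_iff_dist_tendsto_zero]
  have h0 := tendsto_iff_dist_tendsto_zero.1 (hf' x)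
  refine h0.congr fun i => ?_
  rw [← (u (φ (ψ i))).dist_eq, IsometryEquiv.apply_symm_apply, dist_comm]
  rfl

/-- A group of isometries that is closed under pointwise limits of sequences. -/
def IsPointwiseClosed (G : Subgroup (S ≃ᵢ S)) : Prop :=
  ∀ (u : ℕ → G) (g : S ≃ᵢ S),
    (∀ p, Tendsto (fun i => (u i : S ≃ᵢ S) p) atTop (𝓝 (g p))) → g ∈ G

theorem IsPointwiseClosed.exists_subseq_tendsto [ProperSpace S] {G : Subgroup (S ≃ᵢ S)}
    (hG : IsPointwiseClosed G) (O : S) {r : ℝ} (u : ℕ → G)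
    (hu : ∀ i, dist O ((u i : S ≃ᵢ S) O) ≤ r) :
    ∃ φ : ℕ → ℕ, StrictMono φ ∧ ∃ g : G,
      ∀ p, Tendsto (fun i => (u (φ i) : S ≃ᵢ S) p) atTop (𝓝 ((g : S ≃ᵢ S) p)) := by
  obtain ⟨φ, hφ, g, hg⟩ := exists_subseq_tendsto_isometryEquiv O (fun i => (u i : S ≃ᵢ S)) hu
  exact ⟨φ, hφ, ⟨g, hG (u ∘ φ) g hg⟩, hg⟩

/-- The image of a nonempty compact set under an isometry. -/
def isometryCopy (g : S ≃ᵢ S) (C : NonemptyCompacts S) : NonemptyCompacts S := C.map g g.continuous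

@[simp] theorem coe_isometryCopy (g : S ≃ᵢ S) (C : NonemptyCompacts S) :
    (isometryCopy g C : Set S) = g '' C := rfl

theorem isometryCopy_mul (g h : S ≃ᵢ S) (C : NonemptyCompacts S) :
    isometryCopy (g * h) C = isometryCopy g (isometryCopy h C) :=
  SetLike.coe_injective (by simp [IsometryEquiv.coe_mul, image_comp])

theorem isometryCopy_one (C : NonemptyCompacts S) : isometryCopy 1 C = C :=
  SetLike.coe_injective (by simp)

theorem dist_isometryCopy (g : S ≃ᵢ S) (C D : NonemptyCompacts S) :
    dist (isometryCopy g C) (isometryCopy g D) = dist C D := by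
  rw [Metric.NonemptyCompacts.dist_eq, Metric.NonemptyCompacts.dist_eq, coe_isometryCopy,
    coe_isometryCopy, Metric.hausdorffDist_image g.isometry]

theorem exists_dist_lt_of_nonemptyCompacts {C D : NonemptyCompacts S} {x : S} (hx : x ∈ C) {r : ℝ}
    (h : dist C D < r) : ∃ y ∈ D, dist x y < r :=
  Metric.exists_dist_lt_of_hausdorffDist_lt hx h
    (Metric.hausdorffEDist_ne_top_of_nonempty_of_bounded C.nonempty D.nonempty
      C.isCompact.isBounded D.isCompact.isBounded)

/-- Pointwise convergence of isometries is uniform on compact sets. -/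
theorem tendsto_isometryCopy {u : ℕ → S ≃ᵢ S} {g : S ≃ᵢ S}
    (h : ∀ p, Tendsto (fun i => u i p) atTop (𝓝 (g p))) (C : NonemptyCompacts S) :
    Tendsto (fun i => isometryCopy (u i) C) atTop (𝓝 (isometryCopy g C)) := by
  rw [Metric.tendsto_atTop']
  intro ε hε
  obtain ⟨t, -, ht, hCt⟩ := C.isCompact.finite_cover_balls (e := ε / 4) (by positivity)
  have hev : ∀ᶠ i in atTop, ∀ x ∈ t, dist (u i x) (g x) < ε / 4 :=
    (eventually_all_finite ht).2 fun x _ => (Metric.tendsto_nhds.1 (h x)) _ (by positivity)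
  obtain ⟨N, hN⟩ := eventually_atTop.1 hev
  refine ⟨N, fun i hi => ?_⟩
  have hy : ∀ y ∈ C, dist (u i y) (g y) ≤ 3 * (ε / 4) := fun y hy => by
    obtain ⟨x, hx, hyx⟩ := mem_iUnion₂.1 (hCt hy)
    have h1 := hN i hi.le x hx
    have h4 := dist_triangle4 (u i y) (u i x) (g x) (g y)
    rw [(u i).dist_eq, g.dist_eq, dist_comm x y] at h4
    have : dist y x < ε / 4 := hyx
    linarith
  refine lt_of_le_of_lt ?_ (show 3 * (ε / 4) < ε by linarith)
  rw [Metric.NonemptyCompacts.dist_eq]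
  refine Metric.hausdorffDist_le_of_mem_dist (by positivity) ?_ ?_
  · rintro _ ⟨y, hyC, rfl⟩
    exact ⟨g y, ⟨y, hyC, rfl⟩, hy y hyC⟩
  · rintro _ ⟨y, hyC, rfl⟩
    exact ⟨u i y, ⟨y, hyC, rfl⟩, by rw [dist_comm]; exact hy y hyC⟩

theorem tendsto_symm_apply {u : ℕ → S ≃ᵢ S} {g : S ≃ᵢ S}
    (h : ∀ p, Tendsto (fun i => u i p) atTop (𝓝 (g p))) (p : S) :
    Tendsto (fun i => (u i).symm p) atTop (𝓝 (g.symm p)) := by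
  rw [tendsto_iff_dist_tendsto_zero]
  refine (tendsto_iff_dist_tendsto_zero.1 (h (g.symm p))).congr fun i => ?_
  rw [← (u i).dist_eq ((u i).symm p), IsometryEquiv.apply_symm_apply,
    IsometryEquiv.apply_symm_apply, dist_comm]

end Isometries

/-! ### Nearby copies of a compact set -/

section Copies

variable {S : Type*} [MetricSpace S] {G : Subgroup (S ≃ᵢ S)} {O : S} {C : NonemptyCompacts S}

theorem exists_subset_closedBall (O : S) (C : NonemptyCompacts S) :
    ∃ b : ℝ, (C : Set S) ⊆ Metric.closedBall O b :=
  C.isCompact.isBounded.subset_closedBall O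

theorem dist_apply_le_of_copy_meets {b r : ℝ} (hb : (C : Set S) ⊆ Metric.closedBall O b)
    {g : S ≃ᵢ S} (h : ((isometryCopy g C : Set S) ∩ Metric.closedBall O r).Nonempty) :
    dist O (g O) ≤ r + b := by
  obtain ⟨_, ⟨p, hp, rfl⟩, hr⟩ := h
  have h1 : dist p O ≤ b := hb hp
  have h2 : dist (g p) O ≤ r := hr
  have h3 := dist_triangle O (g p) (g O)
  rw [g.dist_eq, dist_comm O (g p)] at h3
  linarith

theorem copy_meets_of_dist_apply_le {b r : ℝ} (hb : (C : Set S) ⊆ Metric.closedBall O b)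
    {g : S ≃ᵢ S} (h : dist O (g O) ≤ r) :
    ((isometryCopy g C : Set S) ∩ Metric.closedBall O (r + b)).Nonempty := by
  obtain ⟨p, hp⟩ := C.nonempty
  refine ⟨g p, ⟨p, hp, rfl⟩, ?_⟩
  have h1 : dist p O ≤ b := hb hp
  have h3 := dist_triangle (g p) (g O) O
  rw [g.dist_eq, dist_comm (g O) O] at h3
  rw [Metric.mem_closedBall]
  linarith

/-- The copies of `C` under motions that move the base point by a bounded amount form a compact set
for the Hausdorff distance. -/
theorem isCompact_copies [ProperSpace S] (hG : IsPointwiseClosed G) (O : S)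
    (C : NonemptyCompacts S) (r : ℝ) :
    IsCompact {D | ∃ g : G, dist O ((g : S ≃ᵢ S) O) ≤ r ∧ D = isometryCopy g C} := by
  refine IsSeqCompact.isCompact fun x hx => ?_
  choose u hu hxu using hx
  obtain ⟨φ, hφ, g, hg⟩ := hG.exists_subseq_tendsto O u hu
  refine ⟨isometryCopy g C, ⟨g, ?_, rfl⟩, φ, hφ, ?_⟩
  · exact le_of_tendsto (tendsto_const_nhds.dist (hg O)) (Eventually.of_forall fun i => hu _)
  · refine (tendsto_isometryCopy hg C).congr fun i => ?_
    rw [Function.comp_apply, hxu]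

/-- Motions whose copies of `C` converge to `C` subconverge to a symmetry of `C`. -/
theorem exists_subseq_of_tendsto_copy [ProperSpace S] (hG : IsPointwiseClosed G) (O : S)
    (u : ℕ → G) (hu : Tendsto (fun i => isometryCopy (u i) C) atTop (𝓝 C)) :
    ∃ φ : ℕ → ℕ, StrictMono φ ∧ ∃ g : G, isometryCopy g C = C ∧
      ∀ p, Tendsto (fun i => (u (φ i) : S ≃ᵢ S) p) atTop (𝓝 ((g : S ≃ᵢ S) p)) := by
  obtain ⟨b, hb⟩ := exists_subset_closedBall O C
  obtain ⟨N, hN⟩ := eventually_atTop.1 (Metric.tendsto_nhds.1 hu 1 one_pos)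
  obtain ⟨φ, hφ, g, hg⟩ := hG.exists_subseq_tendsto O (fun i => u (i + N)) (r := b + 1 + b)
    fun i => by
      refine dist_apply_le_of_copy_meets hb ?_
      have h1 := hN (i + N) (by omega)
      rw [dist_comm] at h1
      obtain ⟨q, hq⟩ := C.nonempty
      obtain ⟨y, hy, hqy⟩ := exists_dist_lt_of_nonemptyCompacts hq h1
      refine ⟨y, hy, ?_⟩
      have h2 : dist q O ≤ b := hb hq
      have h3 := dist_triangle_left y O q
      rw [Metric.mem_closedBall]
      linarith
  have hmono : StrictMono fun i => φ i + N := fun a b h => by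
    have := hφ h
    simpa using this
  refine ⟨fun i => φ i + N, hmono, g, ?_, hg⟩
  exact tendsto_nhds_unique (tendsto_isometryCopy hg C) (hu.comp hmono.tendsto_atTop)

theorem exists_seq_tendsto_of_forall_exists {α : Type*} {f : α → ℝ} (hf : ∀ a, 0 ≤ f a)
    {p : α → Prop} (h : ∀ η > 0, ∃ a, f a < η ∧ p a) :
    ∃ u : ℕ → α, Tendsto (fun i => f (u i)) atTop (𝓝 0) ∧ ∀ i, p (u i) := by
  choose u hu hp using fun i : ℕ => h (1 / ((i : ℝ) + 1)) Nat.one_div_pos_of_nat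
  exact ⟨u, squeeze_zero (fun i => hf _) (fun i => (hu i).le)
    tendsto_one_div_add_atTop_nhds_zero_nat, hp⟩

/-- An interior point of `C` is an interior point of all copies of `C` close to `C`. -/
theorem exists_forall_mem_interior_copy [ProperSpace S] (hG : IsPointwiseClosed G) {x : S}
    (hx : x ∈ interior (C : Set S)) :
    ∃ η > 0, ∀ g : G, dist (isometryCopy g C) C < η → x ∈ interior (isometryCopy g C : Set S) := by
  by_contra! hcon
  obtain ⟨u, hu, hn⟩ := exists_seq_tendsto_of_forall_exists (fun _ => dist_nonneg) hcon
  obtain ⟨φ, hφ, g, hgC, hg⟩ := exists_subseq_of_tendsto_copy hG x u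
    (tendsto_iff_dist_tendsto_zero.2 hu)
  have himg : ∀ h : S ≃ᵢ S, x ∈ interior (isometryCopy h C : Set S) ↔
      h.symm x ∈ interior (C : Set S) := fun h => by
    have : interior (h '' (C : Set S)) = h '' interior (C : Set S) :=
      (h.toHomeomorph.image_interior (C : Set S)).symm
    rw [coe_isometryCopy, this]
    constructor
    · rintro ⟨y, hy, rfl⟩
      rwa [IsometryEquiv.symm_apply_apply]
    · exact fun hy => ⟨_, hy, IsometryEquiv.apply_symm_apply _ _⟩
  have hgx : (g : S ≃ᵢ S).symm x ∈ interior (C : Set S) := (himg g).1 (by rwa [hgC])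
  obtain ⟨i, hi⟩ := ((tendsto_symm_apply hg x).eventually
    (isOpen_interior.mem_nhds hgx)).exists
  exact hn (φ i) ((himg _).2 hi)

namespace InvariantDist

variable (δ : InvariantDist G O)

theorem d_nonneg (g h : G) : 0 ≤ δ.d g h := by
  have h1 := δ.triangle g h g
  rw [δ.comm h g, (δ.eq_zero_iff g g).2 rfl] at h1
  linarith

theorem d_eq_one (g h : G) : δ.d g h = δ.d 1 (g⁻¹ * h) := by
  rw [← δ.left_inv g⁻¹, inv_mul_cancel]

theorem dist_apply_le (g h : G) : dist ((g : S ≃ᵢ S) O) ((h : S ≃ᵢ S) O) ≤ δ.d g h :=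
  (δ.isGLB_lifts _ _).1 ⟨g, h, rfl, rfl, rfl⟩

/-- A motion close to the identity moves `C` by a small Hausdorff distance. -/
theorem exists_forall_dist_copy_lt (C : NonemptyCompacts S) {ε : ℝ} (hε : 0 < ε) :
    ∃ η > 0, ∀ g : G, δ.d 1 g < η → dist C (isometryCopy g C) < ε := by
  by_contra! hcon
  obtain ⟨u, hu, hn⟩ := exists_seq_tendsto_of_forall_exists (δ.d_nonneg 1) hcon
  have h1 := (δ.tendsto_iff u 1).1 (hu.congr fun i => δ.comm _ _)
  have h2 := tendsto_isometryCopy h1 C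
  rw [Subgroup.coe_one, isometryCopy_one] at h2
  obtain ⟨i, hi⟩ := (Metric.tendsto_nhds.1 h2 ε hε).exists
  rw [dist_comm] at hi
  exact absurd hi (not_lt.2 (hn i))

/-- A motion that almost maps `C` onto itself is close to a symmetry of `C`. -/
theorem exists_forall_exists_symmetry [ProperSpace S] (hG : IsPointwiseClosed G)
    (C : NonemptyCompacts S) {ε : ℝ} (hε : 0 < ε) :
    ∃ η > 0, ∀ g : G, dist (isometryCopy g C) C < η →
      ∃ s : G, isometryCopy s C = C ∧ δ.d s g < ε := by
  by_contra! hcon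
  obtain ⟨u, hu, hn⟩ := exists_seq_tendsto_of_forall_exists (fun _ => dist_nonneg) hcon
  obtain ⟨φ, hφ, s, hsC, hs⟩ := exists_subseq_of_tendsto_copy hG O u
    (tendsto_iff_dist_tendsto_zero.2 hu)
  have h1 := (δ.tendsto_iff (u ∘ φ) s).2 hs
  obtain ⟨i, hi⟩ := (h1.eventually (gt_mem_nhds hε)).exists
  rw [δ.comm] at hi
  exact absurd hi (not_lt.2 (hn (φ i) s hsC))

/-- The motions that move the base point by a bounded amount are bounded for the distance on `G`:
otherwise they would contain a sequence that goes to infinity but has a convergent subsequence. -/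
theorem exists_forall_d_le [ProperSpace S] (hG : IsPointwiseClosed G) (r : ℝ) :
    ∃ m : ℕ, ∀ g : G, dist O ((g : S ≃ᵢ S) O) ≤ r → δ.d 1 g ≤ m := by
  by_contra! hcon
  choose u hu hn using hcon
  obtain ⟨φ, hφ, g, hg⟩ := hG.exists_subseq_tendsto O u hu
  have h1 := (δ.tendsto_iff (u ∘ φ) g).2 hg
  obtain ⟨N, hN⟩ := eventually_atTop.1 (h1.eventually (gt_mem_nhds one_pos))
  obtain ⟨M, hM⟩ := exists_nat_ge (δ.d 1 g + 1)
  have h2 := hN (max N M) (le_max_left _ _)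
  have h3 := hn (φ (max N M))
  have h4 : (M : ℝ) ≤ φ (max N M) := by
    exact_mod_cast (le_max_right N M).trans (hφ.id_le _)
  have h5 := δ.triangle 1 g (u (φ (max N M)))
  rw [δ.comm g] at h5
  simp only [Function.comp_apply] at h2
  linarith

end InvariantDist

end Copies

/-! ### The packing space in terms of the Hausdorff distance -/

namespace PackingSpace

variable {S : Type*} [MetricSpace S] {G : Subgroup (S ≃ᵢ S)} {O : S} {C : NonemptyCompacts S}
  {δ : InvariantDist G O}

/-- The bodies of a packing by `C`, as points of the space of nonempty compact sets with the
Hausdorff distance. -/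
def copies (P : PackingSpace δ (C : Set S)) : Set (NonemptyCompacts S) :=
  {D | (D : Set S) ∈ P.bodies}

theorem exists_eq_copy {P : PackingSpace δ (C : Set S)} {D : NonemptyCompacts S}
    (hD : D ∈ P.copies) : ∃ g : G, D = isometryCopy g C := by
  obtain ⟨g, hg⟩ := P.congruent _ hD
  exact ⟨g, SetLike.coe_injective hg⟩

theorem exists_copy_of_mem_bodies {P : PackingSpace δ (C : Set S)} {A : Set S}
    (hA : A ∈ P.bodies) : ∃ D ∈ P.copies, (D : Set S) = A := by
  obtain ⟨g, rfl⟩ := P.congruent _ hA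
  exact ⟨isometryCopy g C, hA, rfl⟩

theorem ext_copies {P Q : PackingSpace δ (C : Set S)} (h : P.copies = Q.copies) : P = Q := by
  refine PackingSpace.ext (Set.ext fun A => ⟨fun hA => ?_, fun hA => ?_⟩)
  · obtain ⟨D, hD, rfl⟩ := exists_copy_of_mem_bodies hA
    exact h.subset hD
  · obtain ⟨D, hD, rfl⟩ := exists_copy_of_mem_bodies hA
    exact h.superset hD

theorem eq_of_mem_interior {P : PackingSpace δ (C : Set S)} {D E : NonemptyCompacts S}
    (hD : D ∈ P.copies) (hE : E ∈ P.copies) {z : S} (hzD : z ∈ interior (D : Set S))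
    (hzE : z ∈ interior (E : Set S)) : D = E := by
  by_contra hne
  exact (P.disjoint _ hD _ hE fun h => hne (SetLike.coe_injective h)).le_bot ⟨hzD, hzE⟩

theorem mem_symmetryGroup_iff {s : G} :
    s ∈ symmetryGroup G (C : Set S) ↔ isometryCopy s C = C :=
  ⟨fun h => SetLike.coe_injective h, fun h => congrArg (SetLike.coe) h⟩

theorem isometryCopy_eq_of_coset_eq {g h : G}
    (e : (g : G ⧸ symmetryGroup G (C : Set S)) = h) : isometryCopy (g : S ≃ᵢ S) C
      = isometryCopy (h : S ≃ᵢ S) C := by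
  have h1 := mem_symmetryGroup_iff.1 (QuotientGroup.eq.1 e)
  rw [← h1, ← isometryCopy_mul, ← Subgroup.coe_mul, mul_inv_cancel_left, h1]

theorem mk_mem_cosets_iff {P : PackingSpace δ (C : Set S)} {g : G} :
    (g : G ⧸ symmetryGroup G (C : Set S)) ∈ P.cosets ↔
      isometryCopy (g : S ≃ᵢ S) C ∈ P.copies := by
  constructor
  · rintro ⟨h, e, hh⟩
    rw [← isometryCopy_eq_of_coset_eq e]
    exact hh
  · exact fun h => ⟨g, rfl, h⟩

/-- The infimum defining `cosetDist` runs over the pairs of motions with the same copies of `C`. -/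
theorem cosetDist_lt_iff {g h : G} {ε : ℝ} :
    cosetDist δ (C : Set S) g h < ε ↔ ∃ g' h' : G, isometryCopy (g' : S ≃ᵢ S) C
      = isometryCopy (g : S ≃ᵢ S) C ∧ isometryCopy (h' : S ≃ᵢ S) C
      = isometryCopy (h : S ≃ᵢ S) C ∧ δ.d g' h' < ε := by
  have hmk : ∀ a b : G, isometryCopy (a : S ≃ᵢ S) C = isometryCopy (b : S ≃ᵢ S) C →
      (a : G ⧸ symmetryGroup G (C : Set S)) = b := fun a b e => by
    rw [QuotientGroup.eq, mem_symmetryGroup_iff, Subgroup.coe_mul, isometryCopy_mul, ← e,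
      ← isometryCopy_mul, ← Subgroup.coe_mul, inv_mul_cancel, Subgroup.coe_one, isometryCopy_one]
  rw [cosetDist, csInf_lt_iff]
  · constructor
    · rintro ⟨_, ⟨g', h', eg, eh, rfl⟩, hlt⟩
      exact ⟨g', h', isometryCopy_eq_of_coset_eq eg, isometryCopy_eq_of_coset_eq eh, hlt⟩
    · rintro ⟨g', h', eg, eh, hlt⟩
      exact ⟨_, ⟨g', h', hmk _ _ eg, hmk _ _ eh, rfl⟩, hlt⟩
  · refine ⟨0, ?_⟩
    rintro _ ⟨g', h', -, -, rfl⟩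
    exact δ.d_nonneg _ _
  · exact ⟨_, g, h, rfl, rfl, rfl⟩

/-- Every body of `P` that meets the closed ball of radius `r` about the base point is
`ε`-close to a body of `Q`. -/
def Approximates (r ε : ℝ) (P Q : PackingSpace δ (C : Set S)) : Prop :=
  ∀ D ∈ P.copies, ((D : Set S) ∩ Metric.closedBall O r).Nonempty → ∃ E ∈ Q.copies, dist D E < ε

theorem Approximates.mono {r r' ε ε' : ℝ} {P Q : PackingSpace δ (C : Set S)}
    (h : Approximates r ε P Q) (hr : r' ≤ r) (hε : ε ≤ ε') : Approximates r' ε' P Q := by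
  intro D hD hm
  obtain ⟨E, hE, hlt⟩ := h D hD
    (hm.mono (inter_subset_inter_right _ (Metric.closedBall_subset_closedBall hr)))
  exact ⟨E, hE, hlt.trans_le hε⟩

theorem Approximates.trans {r ε ε' : ℝ} {P Q R : PackingSpace δ (C : Set S)}
    (h : Approximates r ε P Q) (h' : Approximates (r + ε) ε' Q R) :
    Approximates r (ε + ε') P R := by
  rintro D hD ⟨x, hxD, hx⟩
  obtain ⟨E, hE, hlt⟩ := h D hD ⟨x, hxD, hx⟩
  obtain ⟨y, hyE, hy⟩ := exists_dist_lt_of_nonemptyCompacts hxD hlt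
  obtain ⟨F, hF, hlt'⟩ := h' E hE ⟨y, hyE, by
    rw [Metric.mem_closedBall] at hx ⊢
    linarith [dist_triangle_left y O x]⟩
  exact ⟨F, hF, (dist_triangle _ _ _).trans_lt (add_lt_add hlt hlt')⟩

/-- An inclusion of a coset window in a coset neighbourhood forces approximation in the Hausdorff
distance. -/
theorem exists_forall_approximates [ProperSpace S] (hG : IsPointwiseClosed G)
    (δ : InvariantDist G O) (C : NonemptyCompacts S) (r : ℝ) {ε : ℝ} (hε : 0 < ε) :
    ∃ m : ℕ, 1 ≤ m ∧ ∃ η > 0, ∀ P Q : PackingSpace δ (C : Set S),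
      cosetBall δ (C : Set S) m ∩ P.cosets ⊆ cosetNhd δ (C : Set S) η Q.cosets →
        Approximates r ε P Q := by
  obtain ⟨b, hb⟩ := exists_subset_closedBall O C
  obtain ⟨m, hm⟩ := δ.exists_forall_d_le hG (r + b)
  obtain ⟨η, hη, h⟩ := δ.exists_forall_dist_copy_lt C hε
  refine ⟨m + 1, by omega, η, hη, fun P Q hPQ D hD hDr => ?_⟩
  obtain ⟨g, rfl⟩ := exists_eq_copy hD
  have hball : (g : G ⧸ symmetryGroup G (C : Set S)) ∈ cosetBall δ (C : Set S) (m + 1 : ℕ) := by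
    refine (cosetDist_lt_iff.2 ⟨1, g, rfl, rfl, ?_⟩).le
    have := hm g (dist_apply_le_of_copy_meets hb hDr)
    push_cast
    linarith
  obtain ⟨x, hx, hlt⟩ := hPQ ⟨hball, mk_mem_cosets_iff.2 hD⟩
  obtain ⟨k, rfl⟩ := QuotientGroup.mk_surjective x
  obtain ⟨k', g', ek, eg, hd⟩ := cosetDist_lt_iff.1 hlt
  refine ⟨isometryCopy k C, mk_mem_cosets_iff.1 hx, ?_⟩
  have h1 := h (k'⁻¹ * g') (by rwa [← δ.d_eq_one])
  rw [← dist_isometryCopy (k' : S ≃ᵢ S), ← isometryCopy_mul, ← Subgroup.coe_mul,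
    mul_inv_cancel_left, ek, eg, dist_comm] at h1
  exact h1

/-- Approximation in the Hausdorff distance forces an inclusion of a coset window in a coset
neighbourhood. -/
theorem exists_forall_subset_cosetNhd [ProperSpace S] (hG : IsPointwiseClosed G)
    (δ : InvariantDist G O) (C : NonemptyCompacts S) (m : ℝ) {ε : ℝ} (hε : 0 < ε) :
    ∃ r : ℝ, ∃ η > 0, ∀ P Q : PackingSpace δ (C : Set S), Approximates r η P Q →
      cosetBall δ (C : Set S) m ∩ P.cosets ⊆ cosetNhd δ (C : Set S) ε Q.cosets := by
  obtain ⟨b, hb⟩ := exists_subset_closedBall O C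
  obtain ⟨η, hη, h⟩ := δ.exists_forall_exists_symmetry hG C hε
  have hmeet : ((C : Set S) ∩ Metric.closedBall O b).Nonempty := by
    obtain ⟨p, hp⟩ := C.nonempty
    exact ⟨p, hp, hb hp⟩
  refine ⟨(b + b) + (m + 1) + b, η, hη, fun P Q hPQ y => ?_⟩
  rintro ⟨hball, hy⟩
  obtain ⟨g, rfl⟩ := QuotientGroup.mk_surjective y
  obtain ⟨s, g', es, eg, hd⟩ := cosetDist_lt_iff.1 (lt_of_le_of_lt hball (lt_add_one m))
  have hs : dist O ((s : S ≃ᵢ S) O) ≤ b + b := by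
    refine dist_apply_le_of_copy_meets hb ?_
    rw [es, Subgroup.coe_one, isometryCopy_one]
    exact hmeet
  have hg' : dist O ((g' : S ≃ᵢ S) O) ≤ (b + b) + (m + 1) := by
    have h1 := dist_triangle O ((s : S ≃ᵢ S) O) ((g' : S ≃ᵢ S) O)
    have h2 := δ.dist_apply_le s g'
    linarith
  have hmeet' := copy_meets_of_dist_apply_le hb hg'
  rw [eg] at hmeet'
  obtain ⟨E, hE, hlt⟩ := hPQ _ (mk_mem_cosets_iff.1 hy) hmeet'
  obtain ⟨k, rfl⟩ := exists_eq_copy hE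
  obtain ⟨t, ht, htd⟩ := h (k⁻¹ * g) (by
    rwa [← dist_isometryCopy (k : S ≃ᵢ S), ← isometryCopy_mul, ← Subgroup.coe_mul,
      mul_inv_cancel_left])
  refine ⟨k, mk_mem_cosets_iff.2 hE, cosetDist_lt_iff.2 ⟨k * t, g, ?_, rfl, ?_⟩⟩
  · rw [Subgroup.coe_mul, isometryCopy_mul, ht]
  · rwa [← δ.left_inv k, mul_inv_cancel_left] at htd

/-- The `k`-th basic entourage: the pairs of packings that approximate each other within
`1 / (k + 1)` on the ball of radius `k`. -/
def entourage (δ : InvariantDist G O) (C : NonemptyCompacts S) (k : ℕ) :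
    Set (PackingSpace δ (C : Set S) × PackingSpace δ (C : Set S)) :=
  {x | Approximates k (1 / ((k : ℝ) + 1)) x.1 x.2 ∧ Approximates k (1 / ((k : ℝ) + 1)) x.2 x.1}

theorem entourage_anti {j k : ℕ} (h : j ≤ k) : entourage δ C k ⊆ entourage δ C j := by
  have h1 : (j : ℝ) ≤ k := by exact_mod_cast h
  have h2 : 1 / ((k : ℝ) + 1) ≤ 1 / ((j : ℝ) + 1) := Nat.one_div_le_one_div h
  exact fun x hx => ⟨hx.1.mono h1 h2, hx.2.mono h1 h2⟩

theorem mem_entourage_self (k : ℕ) (P : PackingSpace δ (C : Set S)) : (P, P) ∈ entourage δ C k := by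
  have : Approximates k (1 / ((k : ℝ) + 1)) P P := fun D hD _ =>
    ⟨D, hD, by rw [dist_self]; exact Nat.one_div_pos_of_nat⟩
  exact ⟨this, this⟩

theorem entourage_trans {k : ℕ} {P Q R : PackingSpace δ (C : Set S)}
    (h : (P, Q) ∈ entourage δ C (2 * k + 1)) (h' : (Q, R) ∈ entourage δ C (2 * k + 1)) :
    (P, R) ∈ entourage δ C k := by
  have hk : (k : ℝ) + 1 / (((2 * k + 1 : ℕ) : ℝ) + 1) ≤ ((2 * k + 1 : ℕ) : ℝ) := by
    have : 1 / (((2 * k + 1 : ℕ) : ℝ) + 1) ≤ 1 := by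
      rw [div_le_one (by positivity)]
      linarith [(Nat.cast_nonneg (2 * k + 1) : (0 : ℝ) ≤ _)]
    push_cast at this ⊢
    linarith [(Nat.cast_nonneg k : (0 : ℝ) ≤ _)]
  have he : 1 / (((2 * k + 1 : ℕ) : ℝ) + 1) + 1 / (((2 * k + 1 : ℕ) : ℝ) + 1)
      = 1 / ((k : ℝ) + 1) := by
    push_cast
    field_simp
    ring
  have hk' : (k : ℝ) ≤ ((2 * k + 1 : ℕ) : ℝ) := by exact_mod_cast (by omega : k ≤ 2 * k + 1)
  constructor
  · have := (h.1.mono hk' le_rfl).trans (h'.1.mono hk le_rfl)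
    exact this.mono le_rfl he.le
  · have := (h'.2.mono hk' le_rfl).trans (h.2.mono hk le_rfl)
    exact this.mono le_rfl he.le

theorem exists_forall_packingDist_lt_mem_entourage [ProperSpace S] (hG : IsPointwiseClosed G)
    (δ : InvariantDist G O) (C : NonemptyCompacts S) (k : ℕ) :
    ∃ e : ℝ≥0∞, 0 < e ∧ ∀ P Q : PackingSpace δ (C : Set S), packingDist P Q < e →
      (P, Q) ∈ entourage δ C k := by
  obtain ⟨m, hm1, η, hη, h⟩ := exists_forall_approximates hG δ C k
    (Nat.one_div_pos_of_nat : 0 < 1 / ((k : ℝ) + 1))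
  have hm0 : (m : ℝ≥0∞) ≠ 0 := by
    simp only [ne_eq, Nat.cast_eq_zero]
    omega
  refine ⟨min (ENNReal.ofReal η / m) (1 / m), lt_min ?_ ?_, fun P Q hPQ => ?_⟩
  · exact ENNReal.div_pos (by simpa using hη) (ENNReal.natCast_ne_top m)
  · exact ENNReal.div_pos one_ne_zero (ENNReal.natCast_ne_top m)
  have h1 : min (windowDist m P Q / m) (1 / m) ≤ packingDist P Q :=
    le_iSup₂_of_le (f := fun (n : ℕ) (_ : 1 ≤ n) => min (windowDist n P Q / n) (1 / (n : ℝ≥0∞)))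
      m hm1 le_rfl
  have h2 := h1.trans_lt hPQ
  have h3 : windowDist m P Q / m < ENNReal.ofReal η / m := by
    rcases min_lt_iff.1 h2 with h3 | h3
    · exact h3.trans_le (min_le_left _ _)
    · exact absurd (h3.trans_le (min_le_right _ _)) (lt_irrefl _)
  have h4 : windowDist m P Q < ENNReal.ofReal η := by
    by_contra! hle
    exact absurd (ENNReal.div_le_div_right hle _) (not_le.2 h3)
  obtain ⟨_, ⟨ε, -, hP, hQ, rfl⟩, hlt⟩ := sInf_lt_iff.1 h4
  have hεη : ε < η := (ENNReal.ofReal_lt_ofReal_iff hη).1 hlt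
  have hmono : ∀ X, cosetNhd δ (C : Set S) ε X ⊆ cosetNhd δ (C : Set S) η X :=
    fun X y ⟨x, hx, hxy⟩ => ⟨x, hx, hxy.trans hεη⟩
  exact ⟨h P Q (hP.trans (hmono _)), h Q P (hQ.trans (hmono _))⟩

theorem exists_forall_mem_entourage_packingDist_lt [ProperSpace S] (hG : IsPointwiseClosed G)
    (δ : InvariantDist G O) (C : NonemptyCompacts S) {e : ℝ≥0∞} (he : 0 < e) :
    ∃ k : ℕ, ∀ P Q : PackingSpace δ (C : Set S), (P, Q) ∈ entourage δ C k →
      packingDist P Q < e := by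
  obtain ⟨N, hN⟩ := ENNReal.exists_inv_nat_lt he.ne'
  -- `N` may be zero, so `N + 1` is used: its reciprocal is a positive real.
  have hN1 : (((N + 1 : ℕ) : ℝ≥0∞))⁻¹ < e := by
    refine lt_of_le_of_lt (ENNReal.inv_le_inv.2 ?_) hN
    exact_mod_cast Nat.le_succ N
  have hpos : (0 : ℝ) < ((N + 1 : ℕ) : ℝ)⁻¹ := by positivity
  have hcast : ENNReal.ofReal (((N + 1 : ℕ) : ℝ)⁻¹) = (((N + 1 : ℕ) : ℝ≥0∞))⁻¹ := by
    rw [ENNReal.ofReal_inv_of_pos (by positivity), ENNReal.ofReal_natCast]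
  obtain ⟨r, η, hη, h⟩ := exists_forall_subset_cosetNhd hG δ C (N + 1 : ℕ) hpos
  obtain ⟨k₁, hk₁⟩ := exists_nat_ge r
  obtain ⟨k₂, hk₂⟩ := exists_nat_one_div_lt hη
  refine ⟨max k₁ k₂, fun P Q hPQ => lt_of_le_of_lt (iSup₂_le fun n hn => ?_) hN1⟩
  have hr : r ≤ ((max k₁ k₂ : ℕ) : ℝ) := hk₁.trans (by exact_mod_cast le_max_left _ _)
  have hη' : 1 / (((max k₁ k₂ : ℕ) : ℝ) + 1) ≤ η :=
    (Nat.one_div_le_one_div (le_max_right _ _)).trans hk₂.le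
  rcases le_or_gt n (N + 1) with hle | hgt
  · refine (min_le_left _ _).trans ?_
    have hball : cosetBall δ (C : Set S) n ⊆ cosetBall δ (C : Set S) (N + 1 : ℕ) := by
      intro x hx
      have hx' : cosetDist δ (C : Set S) ((1 : G) : G ⧸ symmetryGroup G (C : Set S)) x ≤ n := hx
      exact hx'.trans (Nat.cast_le.2 hle)
    have hw : windowDist n P Q ≤ (((N + 1 : ℕ) : ℝ≥0∞))⁻¹ := by
      refine sInf_le ⟨_, hpos, ?_, ?_, hcast.symm⟩
      · exact (inter_subset_inter_left _ hball).trans (h P Q (hPQ.1.mono hr hη'))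
      · exact (inter_subset_inter_left _ hball).trans (h Q P (hPQ.2.mono hr hη'))
    refine (ENNReal.div_le_of_le_mul ?_).trans hw
    exact le_mul_of_one_le_right' (by exact_mod_cast hn)
  · refine (min_le_right _ _).trans ?_
    rw [one_div]
    exact ENNReal.inv_le_inv.2 (by exact_mod_cast hgt.le)

/-- The uniform structure with the basic entourages `entourage δ C k`. -/
def uniformCore (δ : InvariantDist G O) (C : NonemptyCompacts S) :
    UniformSpace.Core (PackingSpace δ (C : Set S)) where
  uniformity := ⨅ k : ℕ, 𝓟 (entourage δ C k)
  refl := by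
    refine le_iInf fun k => principal_mono.2 ?_
    rintro ⟨P, Q⟩ (rfl : P = Q)
    exact mem_entourage_self k P
  symm := by
    refine tendsto_iInf.2 fun k => tendsto_principal.2 ?_
    refine mem_iInf_of_mem k (mem_principal.2 ?_)
    exact fun x hx => ⟨hx.2, hx.1⟩
  comp := by
    refine le_iInf fun k => le_principal_iff.2 ?_
    refine mem_of_superset (mem_lift' (mem_iInf_of_mem (2 * k + 1) (mem_principal_self _))) ?_
    rintro ⟨P, R⟩ ⟨Q, h, h'⟩
    exact entourage_trans h h'

theorem hasBasis_uniformCore (δ : InvariantDist G O) (C : NonemptyCompacts S) :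
    (uniformCore δ C).uniformity.HasBasis (fun _ => True) (entourage δ C) :=
  hasBasis_iInf_principal (directed_of_isDirected_le fun _ _ h => entourage_anti h)

/-- `packingDist` and the entourages of Hausdorff approximation define the same topology. -/
theorem topology_eq_uniformCore [ProperSpace S] (hG : IsPointwiseClosed G)
    (δ : InvariantDist G O) (C : NonemptyCompacts S) :
    (inferInstance : TopologicalSpace (PackingSpace δ (C : Set S)))
      = (uniformCore δ C).toTopologicalSpace := by
  refine TopologicalSpace.ext (funext fun U => propext ?_)
  have h1 : IsOpen[(uniformCore δ C).toTopologicalSpace] U ↔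
      ∀ P ∈ U, ∃ k, ∀ Q, (P, Q) ∈ entourage δ C k → Q ∈ U := by
    rw [@isOpen_iff_mem_nhds _ (uniformCore δ C).toTopologicalSpace]
    refine forall₂_congr fun P _ => ?_
    rw [UniformSpace.Core.nhds_toTopologicalSpace,
      ((hasBasis_uniformCore δ C).comap (Prod.mk P)).mem_iff]
    simp [subset_def]
  refine Iff.trans ?_ h1.symm
  change (∀ P ∈ U, ∃ e : ℝ≥0∞, 0 < e ∧ ∀ Q, packingDist P Q < e → Q ∈ U) ↔ _
  refine forall₂_congr fun P _ => ⟨?_, ?_⟩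
  · rintro ⟨e, he, h⟩
    obtain ⟨k, hk⟩ := exists_forall_mem_entourage_packingDist_lt hG δ C he
    exact ⟨k, fun Q hQ => h Q (hk P Q hQ)⟩
  · rintro ⟨k, h⟩
    obtain ⟨e, he, hk⟩ := exists_forall_packingDist_lt_mem_entourage hG δ C k
    exact ⟨e, he, fun Q hQ => h Q (hk P Q hQ)⟩

theorem hasBasis_nhds [ProperSpace S] (hG : IsPointwiseClosed G)
    (P : PackingSpace δ (C : Set S)) :
    (𝓝 P).HasBasis (fun _ : ℕ => True) fun k => {Q | (P, Q) ∈ entourage δ C k} := by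
  have : 𝓝 P = comap (Prod.mk P) (uniformCore δ C).uniformity := by
    rw [← UniformSpace.Core.nhds_toTopologicalSpace, ← topology_eq_uniformCore hG]
  rw [this]
  exact (hasBasis_uniformCore δ C).comap (Prod.mk P)

end PackingSpace

/-! ### Topological properties of the packing space -/

namespace PackingSpace

variable {S : Type*} [MetricSpace S] {G : Subgroup (S ≃ᵢ S)} {O : S} {C : NonemptyCompacts S}
  {δ : InvariantDist G O}

/-- An interior point of a copy of `C` is an interior point of all nearby copies. -/
theorem exists_forall_mem_interior [ProperSpace S] (hG : IsPointwiseClosed G) {g : G} {z : S}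
    (hz : z ∈ interior (isometryCopy (g : S ≃ᵢ S) C : Set S)) :
    ∃ η > 0, ∀ h : G, dist (isometryCopy (g : S ≃ᵢ S) C) (isometryCopy (h : S ≃ᵢ S) C) < η →
      z ∈ interior (isometryCopy (h : S ≃ᵢ S) C : Set S) := by
  have himg : ∀ (k : S ≃ᵢ S) (A : Set S), interior (k '' A) = k '' interior A :=
    fun k A => (k.toHomeomorph.image_interior A).symm
  rw [coe_isometryCopy, himg] at hz
  obtain ⟨x, hx, rfl⟩ := hz
  obtain ⟨η, hη, H⟩ := exists_forall_mem_interior_copy hG hx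
  refine ⟨η, hη, fun h hh => ?_⟩
  have h1 := H (g⁻¹ * h) (by
    rwa [← dist_isometryCopy (g : S ≃ᵢ S), ← isometryCopy_mul, ← Subgroup.coe_mul,
      mul_inv_cancel_left, dist_comm])
  have h2 : isometryCopy (h : S ≃ᵢ S) C
      = isometryCopy (g : S ≃ᵢ S) (isometryCopy ((g⁻¹ * h : G) : S ≃ᵢ S) C) := by
    rw [← isometryCopy_mul, ← Subgroup.coe_mul, mul_inv_cancel_left]
  rw [h2, coe_isometryCopy, himg]
  exact ⟨x, h1, rfl⟩

/-- The set of bodies of a packing is closed among the copies of `C`: nearby bodies share an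
interior point, so the bodies of one packing that approximate a given copy all coincide. -/
theorem mem_copies_of_forall_exists_dist_lt [ProperSpace S] (hG : IsPointwiseClosed G)
    (hC : (interior (C : Set S)).Nonempty) {P : PackingSpace δ (C : Set S)} {g : G}
    (h : ∀ ε > 0, ∃ E ∈ P.copies, dist (isometryCopy (g : S ≃ᵢ S) C) E < ε) :
    isometryCopy (g : S ≃ᵢ S) C ∈ P.copies := by
  have hz : ∃ z, z ∈ interior (isometryCopy (g : S ≃ᵢ S) C : Set S) := by
    obtain ⟨x, hx⟩ := hC
    refine ⟨(g : S ≃ᵢ S) x, ?_⟩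
    have : interior ((g : S ≃ᵢ S) '' (C : Set S)) = (g : S ≃ᵢ S) '' interior (C : Set S) :=
      ((g : S ≃ᵢ S).toHomeomorph.image_interior (C : Set S)).symm
    rw [coe_isometryCopy, this]
    exact ⟨x, hx, rfl⟩
  obtain ⟨z, hz⟩ := hz
  obtain ⟨η, hη, H⟩ := exists_forall_mem_interior hG hz
  have H' : ∀ E ∈ P.copies, dist (isometryCopy (g : S ≃ᵢ S) C) E < η →
      z ∈ interior (E : Set S) := fun E hE hlt => by
    obtain ⟨k, rfl⟩ := exists_eq_copy hE
    exact H k hlt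
  obtain ⟨E, hE, hlt⟩ := h η hη
  have hdist : dist (isometryCopy (g : S ≃ᵢ S) C) E ≤ 0 := by
    refine le_of_forall_pos_lt_add fun ε hε => ?_
    obtain ⟨F, hF, hF'⟩ := h (min ε η) (lt_min hε hη)
    have : E = F := eq_of_mem_interior hE hF (H' E hE hlt)
      (H' F hF (hF'.trans_le (min_le_right _ _)))
    rw [this, zero_add]
    exact hF'.trans_le (min_le_left _ _)
  rwa [dist_le_zero.1 hdist]

theorem subset_of_forall_mem_entourage [ProperSpace S] (hG : IsPointwiseClosed G)
    (hC : (interior (C : Set S)).Nonempty) {P Q : PackingSpace δ (C : Set S)}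
    (h : ∀ k, (P, Q) ∈ entourage δ C k) : P.copies ⊆ Q.copies := by
  intro D hD
  obtain ⟨g, rfl⟩ := exists_eq_copy hD
  refine mem_copies_of_forall_exists_dist_lt hG hC fun ε hε => ?_
  obtain ⟨x, hx⟩ := (isometryCopy (g : S ≃ᵢ S) C).nonempty
  obtain ⟨k₁, hk₁⟩ := exists_nat_ge (dist x O)
  obtain ⟨k₂, hk₂⟩ := exists_nat_one_div_lt hε
  have h1 : (k₁ : ℝ) ≤ ((max k₁ k₂ : ℕ) : ℝ) := by exact_mod_cast le_max_left _ _
  obtain ⟨E, hE, hlt⟩ := (h (max k₁ k₂)).1 _ hD ⟨x, hx, hk₁.trans h1⟩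
  exact ⟨E, hE, hlt.trans ((Nat.one_div_le_one_div (le_max_right _ _)).trans_lt hk₂)⟩

theorem metrizableSpace [ProperSpace S] (hG : IsPointwiseClosed G)
    (δ : InvariantDist G O) (hC : (interior (C : Set S)).Nonempty) :
    TopologicalSpace.MetrizableSpace (PackingSpace δ (C : Set S)) := by
  let _ : UniformSpace (PackingSpace δ (C : Set S)) :=
    UniformSpace.ofCoreEq (uniformCore δ C) _ (topology_eq_uniformCore hG δ C)
  have : (uniformity (PackingSpace δ (C : Set S))).IsCountablyGenerated :=
    (hasBasis_uniformCore δ C).isCountablyGenerated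
  have : T0Space (PackingSpace δ (C : Set S)) := ⟨fun P Q hPQ => by
    have hk : ∀ k, (P, Q) ∈ entourage δ C k := fun k => by
      have h1 : {R | (P, R) ∈ entourage δ C k} ∈ 𝓝 P := (hasBasis_nhds hG P).mem_of_mem trivial
      rw [hPQ.nhds_eq] at h1
      have h2 : Q ∈ {R | (P, R) ∈ entourage δ C k} := mem_of_mem_nhds h1
      exact h2
    exact ext_copies ((subset_of_forall_mem_entourage hG hC hk).antisymm
      (subset_of_forall_mem_entourage hG hC fun k => ⟨(hk k).2, (hk k).1⟩))⟩
  exact UniformSpace.metrizableSpace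

/-- The limit of an ultrafilter of packings: it consists of the copies of `C` that are approximated
by bodies of almost all packings. -/
def ultrafilterLimit [ProperSpace S] (hG : IsPointwiseClosed G)
    (f : Ultrafilter (PackingSpace δ (C : Set S))) : PackingSpace δ (C : Set S) where
  bodies := {A | ∃ g : G, A = (g : S ≃ᵢ S) '' (C : Set S) ∧
    ∀ ε > 0, ∀ᶠ Q in (f : Filter (PackingSpace δ (C : Set S))), ∃ E ∈ Q.copies,
      dist (isometryCopy (g : S ≃ᵢ S) C) E < ε}
  congruent := by
    rintro A ⟨g, rfl, -⟩
    exact ⟨g, rfl⟩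
  disjoint := by
    rintro _ ⟨g, rfl, hg⟩ _ ⟨h, rfl, hh⟩ hne
    by_contra hdis
    obtain ⟨z, hzg, hzh⟩ := not_disjoint_iff.1 hdis
    obtain ⟨η, hη, H⟩ := exists_forall_mem_interior hG (C := C) hzg
    obtain ⟨η', hη', H'⟩ := exists_forall_mem_interior hG (C := C) hzh
    -- Both copies are approximated by bodies of a common packing; these overlap, hence coincide.
    refine hne (congrArg SetLike.coe (dist_le_zero.1 (le_of_forall_pos_lt_add fun ε hε => ?_) :
      isometryCopy (g : S ≃ᵢ S) C = isometryCopy (h : S ≃ᵢ S) C))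
    obtain ⟨Q, ⟨E, hE, hEd⟩, ⟨F, hF, hFd⟩⟩ :=
      ((hg (min η (ε / 2)) (by positivity)).and (hh (min η' (ε / 2)) (by positivity))).exists
    have hEF : E = F := by
      refine eq_of_mem_interior hE hF (z := z) ?_ ?_
      · obtain ⟨k, rfl⟩ := exists_eq_copy hE
        exact H k (hEd.trans_le (min_le_left _ _))
      · obtain ⟨k, rfl⟩ := exists_eq_copy hF
        exact H' k (hFd.trans_le (min_le_left _ _))
    subst hEF
    have h1 := dist_triangle_right (isometryCopy (g : S ≃ᵢ S) C) (isometryCopy (h : S ≃ᵢ S) C) E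
    have h2 := hEd.trans_le (min_le_right _ _)
    have h3 := hFd.trans_le (min_le_right _ _)
    linarith

theorem mem_copies_ultrafilterLimit [ProperSpace S] {hG : IsPointwiseClosed G}
    {f : Ultrafilter (PackingSpace δ (C : Set S))} {D : NonemptyCompacts S} :
    D ∈ (ultrafilterLimit hG f).copies ↔ (∃ g : G, D = isometryCopy (g : S ≃ᵢ S) C) ∧
      ∀ ε > 0, ∀ᶠ Q in (f : Filter (PackingSpace δ (C : Set S))), ∃ E ∈ Q.copies, dist D E < ε := by
  constructor
  · rintro ⟨g, e, h⟩
    obtain rfl : D = isometryCopy (g : S ≃ᵢ S) C := SetLike.coe_injective e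
    exact ⟨⟨g, rfl⟩, h⟩
  · rintro ⟨⟨g, rfl⟩, h⟩
    exact ⟨g, rfl, h⟩

/-- An ultrafilter of packings together with a choice of bodies that meet a fixed ball has a limit
body. -/
theorem exists_tendsto_copy [ProperSpace S] (hG : IsPointwiseClosed G) {r : ℝ}
    (f : Ultrafilter (PackingSpace δ (C : Set S)))
    (F : PackingSpace δ (C : Set S) → NonemptyCompacts S)
    (hF : ∀ᶠ Q in (f : Filter (PackingSpace δ (C : Set S))),
      F Q ∈ Q.copies ∧ ((F Q : Set S) ∩ Metric.closedBall O r).Nonempty) :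
    ∃ g : G, Tendsto F f (𝓝 (isometryCopy (g : S ≃ᵢ S) C)) := by
  obtain ⟨b, hb⟩ := exists_subset_closedBall O C
  obtain ⟨_, ⟨g, -, rfl⟩, hle⟩ := isCompact_iff_ultrafilter_le_nhds.1
    (isCompact_copies hG O C (r + b)) (f.map F) (by
      rw [le_principal_iff, Ultrafilter.mem_coe, Ultrafilter.mem_map]
      filter_upwards [hF] with Q hQ
      obtain ⟨g, hg⟩ := exists_eq_copy hQ.1
      refine ⟨g, dist_apply_le_of_copy_meets hb (hg ▸ hQ.2), hg⟩)
  exact ⟨g, hle⟩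

/-- An ultrafilter of packings converges to `ultrafilterLimit`. -/
theorem ultrafilter_le_nhds_limit [ProperSpace S] (hG : IsPointwiseClosed G)
    (f : Ultrafilter (PackingSpace δ (C : Set S))) :
    (f : Filter _) ≤ 𝓝 (ultrafilterLimit hG f) := by
  rw [(hasBasis_nhds hG _).ge_iff]
  rintro k -
  have hpos : (0 : ℝ) < 1 / ((k : ℝ) + 1) := Nat.one_div_pos_of_nat
  obtain ⟨b, hb⟩ := exists_subset_closedBall O C
  have h1 : ∀ᶠ Q in (f : Filter (PackingSpace δ (C : Set S))),
      Approximates k (1 / ((k : ℝ) + 1)) (ultrafilterLimit hG f) Q := by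
    -- Finitely many bodies of the limit form a net for those that meet the ball.
    obtain ⟨t, htL, ht, hcov⟩ := Metric.finite_approx_of_totallyBounded
      (s := {D | D ∈ (ultrafilterLimit hG f).copies ∧
        ((D : Set S) ∩ Metric.closedBall O k).Nonempty})
      ((isCompact_copies hG O C (k + b)).totallyBounded.subset fun D hD => by
        obtain ⟨g, rfl⟩ := exists_eq_copy hD.1
        exact ⟨g, dist_apply_le_of_copy_meets hb hD.2, rfl⟩) _ (half_pos hpos)
    have hev : ∀ᶠ Q in (f : Filter (PackingSpace δ (C : Set S))), ∀ D ∈ t,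
        ∃ E ∈ Q.copies, dist D E < 1 / ((k : ℝ) + 1) / 2 :=
      (eventually_all_finite ht).2 fun D hD =>
        (mem_copies_ultrafilterLimit.1 (htL hD).1).2 _ (half_pos hpos)
    filter_upwards [hev] with Q hQ D hD hDm
    obtain ⟨D', hD't, hDD'⟩ := mem_iUnion₂.1 (hcov ⟨hD, hDm⟩)
    obtain ⟨E, hE, hlt⟩ := hQ D' hD't
    have h2 : dist D D' < 1 / ((k : ℝ) + 1) / 2 := hDD'
    exact ⟨E, hE, by linarith [dist_triangle D D' E]⟩
  have h2 : ∀ᶠ Q in (f : Filter (PackingSpace δ (C : Set S))),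
      Approximates k (1 / ((k : ℝ) + 1)) Q (ultrafilterLimit hG f) := by
    -- Otherwise almost every packing has a body far from the limit, and these bodies converge to
    -- a copy of `C` that belongs to the limit by definition.
    by_contra hcon
    rw [← Ultrafilter.eventually_not] at hcon
    have hex : ∀ Q : PackingSpace δ (C : Set S), ∃ D : NonemptyCompacts S,
        ¬ Approximates k (1 / ((k : ℝ) + 1)) Q (ultrafilterLimit hG f) →
        (D ∈ Q.copies ∧ ((D : Set S) ∩ Metric.closedBall O k).Nonempty) ∧
          ∀ E ∈ (ultrafilterLimit hG f).copies, 1 / ((k : ℝ) + 1) ≤ dist D E := fun Q => by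
      by_cases hQ : Approximates k (1 / ((k : ℝ) + 1)) Q (ultrafilterLimit hG f)
      · exact ⟨C, fun h => absurd hQ h⟩
      · unfold Approximates at hQ
        push Not at hQ
        obtain ⟨D, hD, hm, hd⟩ := hQ
        exact ⟨D, fun _ => ⟨⟨hD, hm⟩, hd⟩⟩
    choose F hF using hex
    have hFe := hcon.mono hF
    obtain ⟨g, hg⟩ := exists_tendsto_copy hG f F (hFe.mono fun Q hQ => hQ.1)
    have hmem : isometryCopy (g : S ≃ᵢ S) C ∈ (ultrafilterLimit hG f).copies := by
      refine mem_copies_ultrafilterLimit.2 ⟨⟨g, rfl⟩, fun ε hε => ?_⟩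
      filter_upwards [Metric.tendsto_nhds.1 hg ε hε, hFe] with Q h1 h2
      exact ⟨F Q, h2.1.1, by rwa [dist_comm]⟩
    obtain ⟨Q, h1, h2⟩ := ((Metric.tendsto_nhds.1 hg _ hpos).and hFe).exists
    exact absurd h1 (not_lt.2 (h2.2 _ hmem))
  exact h1.and h2

theorem compactSpace [ProperSpace S] (hG : IsPointwiseClosed G) (δ : InvariantDist G O)
    (C : NonemptyCompacts S) : CompactSpace (PackingSpace δ (C : Set S)) :=
  ⟨isCompact_iff_ultrafilter_le_nhds.2 fun f _ =>
    ⟨ultrafilterLimit hG f, mem_univ _, ultrafilter_le_nhds_limit hG f⟩⟩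

/-- The packings that cover the base point form a closed set: the bodies containing it converge
along an ultrafilter, and their limit is a body of the limit packing. -/
theorem isClosed_setOf_mem_covered [ProperSpace S] (hG : IsPointwiseClosed G)
    (δ : InvariantDist G O) (hC : (interior (C : Set S)).Nonempty) :
    IsClosed {P : PackingSpace δ (C : Set S) | O ∈ P.covered} := by
  refine isClosed_iff_ultrafilter.2 fun P f hf hmem => ?_
  have hex : ∀ Q : PackingSpace δ (C : Set S), ∃ D : NonemptyCompacts S,
      O ∈ Q.covered → D ∈ Q.copies ∧ O ∈ (D : Set S) := fun Q => by
    by_cases hQ : O ∈ Q.covered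
    · obtain ⟨A, hA, hO⟩ := hQ
      obtain ⟨D, hD, rfl⟩ := exists_copy_of_mem_bodies hA
      exact ⟨D, fun _ => ⟨hD, hO⟩⟩
    · exact ⟨C, fun h => absurd h hQ⟩
  choose F hF using hex
  have hFe : ∀ᶠ Q in (f : Filter (PackingSpace δ (C : Set S))),
      F Q ∈ Q.copies ∧ O ∈ (F Q : Set S) := by
    filter_upwards [hmem] with Q hQ
    exact hF Q hQ
  have hball : ∀ k : ℕ, O ∈ Metric.closedBall O (k : ℝ) := fun k =>
    Metric.mem_closedBall_self (Nat.cast_nonneg k)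
  obtain ⟨g, hg⟩ := exists_tendsto_copy hG f F (r := (0 : ℕ))
    (hFe.mono fun Q hQ => ⟨hQ.1, O, hQ.2, hball 0⟩)
  refine ⟨_, mem_copies_of_forall_exists_dist_lt hG hC (g := g) fun ε hε => ?_, ?_⟩
  · obtain ⟨k, hk⟩ := exists_nat_one_div_lt (half_pos hε)
    have hnear : ∀ᶠ Q in (f : Filter (PackingSpace δ (C : Set S))), (P, Q) ∈ entourage δ C k :=
      hf ((hasBasis_nhds hG P).mem_of_mem trivial)
    obtain ⟨Q, h1, h2, h3⟩ :=
      ((Metric.tendsto_nhds.1 hg _ (half_pos hε)).and (hFe.and hnear)).exists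
    obtain ⟨E, hE, hlt⟩ := h3.2 _ h2.1 ⟨O, h2.2, hball k⟩
    exact ⟨E, hE, by linarith [dist_triangle_left (isometryCopy (g : S ≃ᵢ S) C) E (F Q)]⟩
  · rw [← (isometryCopy (g : S ≃ᵢ S) C).isCompact.isClosed.closure_eq, Metric.mem_closure_iff]
    intro ε hε
    obtain ⟨Q, h1, h2⟩ := ((Metric.tendsto_nhds.1 hg ε hε).and hFe).exists
    exact exists_dist_lt_of_nonemptyCompacts h2.2 h1

/-! ### The action of the motions -/

instance (K : Set S) : MulAction G (PackingSpace δ K) where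
  one_smul P := PackingSpace.ext (by
    change (fun A => ((1 : G) : S ≃ᵢ S) '' A) '' P.bodies = P.bodies
    simp)
  mul_smul g h P := PackingSpace.ext (by
    change (fun A => ((g * h : G) : S ≃ᵢ S) '' A) '' P.bodies
      = (fun A => (g : S ≃ᵢ S) '' A) '' ((fun A => (h : S ≃ᵢ S) '' A) '' P.bodies)
    rw [image_image]
    simp only [Subgroup.coe_mul, IsometryEquiv.coe_mul, image_comp])

theorem isometryCopy_mem_copies_smul {P : PackingSpace δ (C : Set S)} {D : NonemptyCompacts S}
    (hD : D ∈ P.copies) (g : G) : isometryCopy (g : S ≃ᵢ S) D ∈ (g • P).copies :=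
  ⟨_, hD, rfl⟩

theorem exists_of_mem_copies_smul {P : PackingSpace δ (C : Set S)} {D : NonemptyCompacts S} {g : G}
    (hD : D ∈ (g • P).copies) : ∃ E ∈ P.copies, D = isometryCopy (g : S ≃ᵢ S) E := by
  obtain ⟨A, hA, e⟩ := hD
  obtain ⟨E, hE, rfl⟩ := exists_copy_of_mem_bodies hA
  exact ⟨E, hE, SetLike.coe_injective e.symm⟩

theorem Approximates.smul {r ε : ℝ} {P Q : PackingSpace δ (C : Set S)} (g : G)
    (h : Approximates (r + dist O ((g : S ≃ᵢ S) O)) ε P Q) :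
    Approximates r ε (g • P) (g • Q) := by
  rintro D hD ⟨x, hxD, hx⟩
  obtain ⟨D, hD', rfl⟩ := exists_of_mem_copies_smul hD
  obtain ⟨y, hy, rfl⟩ := hxD
  obtain ⟨E, hE, hlt⟩ := h D hD' ⟨y, hy, by
    have h1 := dist_triangle ((g : S ≃ᵢ S) y) O ((g : S ≃ᵢ S) O)
    rw [(g : S ≃ᵢ S).dist_eq] at h1
    rw [Metric.mem_closedBall] at hx ⊢
    linarith⟩
  exact ⟨_, isometryCopy_mem_copies_smul hE g, by rwa [dist_isometryCopy]⟩

theorem continuousConstSMul [ProperSpace S] (hG : IsPointwiseClosed G) (δ : InvariantDist G O)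
    (C : NonemptyCompacts S) : ContinuousConstSMul G (PackingSpace δ (C : Set S)) where
  continuous_const_smul g := by
    refine continuous_iff_continuousAt.2 fun P => ?_
    refine ((hasBasis_nhds hG P).tendsto_iff (hasBasis_nhds hG (g • P))).2 fun k _ => ?_
    obtain ⟨j, hj⟩ := exists_nat_ge ((k : ℝ) + dist O ((g : S ≃ᵢ S) O))
    have h1 : (k : ℝ) + dist O ((g : S ≃ᵢ S) O) ≤ ((max j k : ℕ) : ℝ) :=
      hj.trans (by exact_mod_cast le_max_left _ _)
    have h2 : 1 / (((max j k : ℕ) : ℝ) + 1) ≤ 1 / ((k : ℝ) + 1) :=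
      Nat.one_div_le_one_div (le_max_right _ _)
    exact ⟨max j k, trivial, fun Q hQ =>
      ⟨(hQ.1.mono h1 h2).smul g, (hQ.2.mono h1 h2).smul g⟩⟩

theorem smul_empty (K : Set S) (g : G) :
    g • (⟨∅, by simp, by simp⟩ : PackingSpace δ K) = ⟨∅, by simp, by simp⟩ :=
  PackingSpace.ext (image_empty _)

/-- The point mass at the empty packing is invariant. -/
theorem invariantMeasures_nonempty [ProperSpace S] (hG : IsPointwiseClosed G)
    (δ : InvariantDist G O) (C : NonemptyCompacts S) :
    (invariantMeasures G (PackingSpace δ (C : Set S))).Nonempty := by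
  have := continuousConstSMul hG δ C
  let P : PackingSpace δ (C : Set S) := ⟨∅, by simp, by simp⟩
  refine ⟨⟨Measure.dirac P, Measure.dirac.isProbabilityMeasure⟩, fun g E hE => ?_⟩
  have hgE : MeasurableSet (g • E) := by
    have hm : Measurable fun x : PackingSpace δ (C : Set S) => g⁻¹ • x :=
      (continuous_const_smul g⁻¹).measurable
    have := hm hE
    rwa [preimage_smul, inv_inv] at this
  change Measure.dirac P (g • E) = Measure.dirac P E
  rw [Measure.dirac_apply' _ hgE, Measure.dirac_apply' _ hE]
  have hP : P ∈ g • E ↔ P ∈ E := by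
    rw [mem_smul_set_iff_inv_smul_mem, smul_empty]
  by_cases h : P ∈ E
  · rw [indicator_of_mem h, indicator_of_mem (hP.2 h)]
  · rw [indicator_of_notMem h, indicator_of_notMem (mt hP.1 h)]

/-- Optimally dense measures exist for every group of isometries of a proper space that is closed
under pointwise limits. -/
theorem exists_isOptimallyDense [ProperSpace S] (hG : IsPointwiseClosed G)
    (δ : InvariantDist G O) {K : Set S} (hK : IsBody K) :
    ∃ μ : Measure (PackingSpace δ K), IsOptimallyDense μ := by
  have hint : (interior K).Nonempty := by
    rw [← closure_nonempty_iff, hK.closure_interior]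
    exact hK.isConnected.nonempty
  obtain ⟨C, rfl⟩ : ∃ C : NonemptyCompacts S, (C : Set S) = K :=
    ⟨⟨⟨K, hK.isCompact⟩, hK.isConnected.nonempty⟩, rfl⟩
  have := compactSpace hG δ C
  have := metrizableSpace hG δ hint
  have := continuousConstSMul hG δ C
  obtain ⟨μ, hμ, herg, hmax⟩ := exists_ergodic_maximizing (Γ := G)
    (isClosed_setOf_mem_covered hG δ hint) (invariantMeasures_nonempty hG δ C)
  have hinv : IsInvariantProbability (μ : Measure (PackingSpace δ (C : Set S))) :=
    ⟨inferInstance, hμ⟩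
  refine ⟨μ, hinv, herg, le_antisymm (le_sSup ⟨μ, hinv, rfl⟩) (sSup_le ?_)⟩
  rintro _ ⟨ν, hν, rfl⟩
  exact hmax ⟨ν, hν.isProbabilityMeasure⟩ hν.invariant

end PackingSpace

/-! ### The motion groups of Euclidean and hyperbolic space -/

/-- A pointwise limit of linear maps of determinant `1` is a linear map of determinant `1`. -/
theorem exists_linearMap_det_one_of_tendsto {V : Type*} [NormedAddCommGroup V] [NormedSpace ℝ V]
    [FiniteDimensional ℝ V] {A : ℕ → V →ₗ[ℝ] V} (hA : ∀ i, LinearMap.det (A i) = 1) {f : V → V}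
    (hf : ∀ v, Tendsto (fun i => A i v) atTop (𝓝 (f v))) :
    ∃ B : V →ₗ[ℝ] V, LinearMap.det B = 1 ∧ ∀ v, B v = f v := by
  let B : V →ₗ[ℝ] V := linearMapOfTendsto f A (tendsto_pi_nhds.2 hf)
  have hB : ∀ v, B v = f v := fun v => rfl
  refine ⟨B, ?_, hB⟩
  let b := Module.finBasis ℝ V
  have hm : Tendsto (fun i => LinearMap.toMatrix b b (A i)) atTop
      (𝓝 (LinearMap.toMatrix b b B)) := by
    refine tendsto_pi_nhds.2 fun j => tendsto_pi_nhds.2 fun k => ?_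
    simp only [LinearMap.toMatrix_apply]
    exact ((b.coord j).continuous_of_finiteDimensional.tendsto _).comp (hf (b k))
  have hd := ((continuous_id.matrix_det).tendsto _).comp hm
  refine tendsto_nhds_unique (l := atTop) (f := fun _ : ℕ => (1 : ℝ)) ?_ tendsto_const_nhds
  rw [← LinearMap.det_toMatrix b]
  refine hd.congr fun i => ?_
  simp only [Function.comp_apply, id]
  rw [LinearMap.det_toMatrix, hA]

theorem isPointwiseClosed_euclideanMotions (n : ℕ) : IsPointwiseClosed (euclideanMotions n) := by
  intro u g hg
  choose A b hA hu using fun i => (u i).2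
  obtain ⟨B, hB, hBf⟩ := exists_linearMap_det_one_of_tendsto hA (f := fun x => g x - g 0)
    fun x => ((hg x).sub (hg 0)).congr fun i => by rw [hu, hu, map_zero]; abel
  exact ⟨B, g 0, hB, fun x => by rw [hBf, sub_add_cancel]⟩

namespace HyperbolicSpace

variable {n : ℕ}

theorem continuous_lorentz : Continuous fun x : HyperbolicSpace n × HyperbolicSpace n =>
    lorentz x.1 x.2 := by
  have : (fun x : HyperbolicSpace n × HyperbolicSpace n => lorentz x.1 x.2)
      = fun x => Real.cosh (dist x.1 x.2) := funext fun x => (cosh_dist _ _).symm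
  rw [this]
  exact Real.continuous_cosh.comp continuous_dist

theorem time_eq_cosh_dist (p : HyperbolicSpace n) : p.time = Real.cosh (dist p (origin n)) := by
  rw [cosh_dist]
  simp [lorentz, origin]

theorem continuous_time : Continuous (time : HyperbolicSpace n → ℝ) := by
  rw [funext time_eq_cosh_dist]
  exact Real.continuous_cosh.comp (continuous_id.dist continuous_const)

theorem norm_space_sub_sq (p q : HyperbolicSpace n) :
    ‖p.space - q.space‖ ^ 2 = (p.time - q.time) ^ 2 + 2 * (lorentz p q - 1) := by
  rw [norm_sub_sq_real]
  unfold lorentz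
  linear_combination -p.time_sq - q.time_sq

theorem continuous_space : Continuous (space : HyperbolicSpace n → EuclideanSpace ℝ (Fin n)) := by
  refine continuous_iff_continuousAt.2 fun q => tendsto_iff_norm_sub_tendsto_zero.2 ?_
  have h1 : Tendsto (fun p : HyperbolicSpace n => (p.time - q.time) ^ 2 + 2 * (lorentz p q - 1))
      (𝓝 q) (𝓝 ((q.time - q.time) ^ 2 + 2 * (lorentz q q - 1))) := by
    refine Continuous.tendsto ?_ q
    have h2 := continuous_time (n := n)
    have h3 : Continuous fun p : HyperbolicSpace n => lorentz p q :=
      continuous_lorentz.comp (continuous_id.prodMk continuous_const)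
    fun_prop
  rw [lorentz_self, sub_self, sub_self, mul_zero, add_zero, zero_pow two_ne_zero] at h1
  have h4 := (Real.continuous_sqrt.tendsto 0).comp h1
  rw [Real.sqrt_zero] at h4
  refine h4.congr fun p => ?_
  rw [Function.comp_apply, ← norm_space_sub_sq, Real.sqrt_sq (norm_nonneg _)]

theorem continuous_toVec :
    Continuous (toVec : HyperbolicSpace n → ℝ × EuclideanSpace ℝ (Fin n)) :=
  continuous_time.prodMk continuous_space

/-- The point of the hyperboloid above `x`. -/
def lift (x : EuclideanSpace ℝ (Fin n)) : HyperbolicSpace n where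
  time := √(1 + ‖x‖ ^ 2)
  space := x
  time_pos := Real.sqrt_pos.2 (by positivity)
  time_sq := Real.sq_sqrt (by positivity)

theorem lift_space (p : HyperbolicSpace n) : lift p.space = p := by
  refine HyperbolicSpace.ext ?_ rfl
  change √(1 + ‖p.space‖ ^ 2) = p.time
  rw [← p.time_sq, Real.sqrt_sq p.time_pos.le]

theorem continuous_lift :
    Continuous (lift : EuclideanSpace ℝ (Fin n) → HyperbolicSpace n) := by
  refine continuous_iff_continuousAt.2 fun y => tendsto_iff_dist_tendsto_zero.2 ?_
  have h1 : Continuous fun x : EuclideanSpace ℝ (Fin n) => lorentz (lift x) (lift y) := by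
    change Continuous fun x : EuclideanSpace ℝ (Fin n) =>
      √(1 + ‖x‖ ^ 2) * √(1 + ‖y‖ ^ 2) - inner ℝ x y
    fun_prop
  have h2 : Continuous fun x : EuclideanSpace ℝ (Fin n) => dist (lift x) (lift y) :=
    Real.continuousOn_arcosh.comp_continuous h1 fun x => one_le_lorentz _ _
  have h3 := h2.tendsto y
  rwa [dist_self] at h3

/-- Closed balls about the origin are images of closed Euclidean balls. -/
instance : ProperSpace (HyperbolicSpace n) := by
  have hc : ∀ r : ℝ, IsCompact (Metric.closedBall (origin n) r) := fun r => by
    refine ((isCompact_closedBall (0 : EuclideanSpace ℝ (Fin n)) (Real.cosh r)).image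
      continuous_lift).of_isClosed_subset Metric.isClosed_closedBall fun p hp => ?_
    refine ⟨p.space, ?_, lift_space p⟩
    rw [mem_closedBall_zero_iff]
    have h1 : p.time ≤ Real.cosh r := by
      rw [time_eq_cosh_dist, Real.cosh_le_cosh, abs_of_nonneg dist_nonneg]
      exact (Metric.mem_closedBall.1 hp).trans (le_abs_self r)
    refine le_trans ?_ h1
    refine (sq_le_sq₀ (norm_nonneg _) p.time_pos.le).1 ?_
    linarith [p.time_sq]
  refine ⟨fun x r => (hc (dist x (origin n) + r)).of_isClosed_subset Metric.isClosed_closedBall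
    fun p hp => ?_⟩
  rw [Metric.mem_closedBall] at hp ⊢
  linarith [dist_triangle p x (origin n)]

/-- Every vector of the ambient Minkowski space is a combination of two points of the hyperboloid,
with coefficients that depend on the vector alone. -/
theorem eq_toVec_add_smul_origin (v : ℝ × EuclideanSpace ℝ (Fin n)) :
    v = (lift v.2).toVec + (v.1 - (lift v.2).time) • (origin n).toVec := by
  refine Prod.ext ?_ ?_
  · simp [toVec, origin]
  · simp [toVec, origin, lift]

end HyperbolicSpace

open HyperbolicSpace in
theorem isPointwiseClosed_hyperbolicMotions (n : ℕ) :
    IsPointwiseClosed (hyperbolicMotions n) := by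
  intro u g hg
  choose A hA hu using fun i => (u i).2
  have hvec : ∀ p, Tendsto (fun i => A i p.toVec) atTop (𝓝 (g p).toVec) := fun p =>
    ((continuous_toVec.tendsto _).comp (hg p)).congr fun i => hu i p
  -- The linear maps are controlled on the hyperboloid only, but this determines them everywhere.
  obtain ⟨B, hB, hBf⟩ := exists_linearMap_det_one_of_tendsto hA
    (f := fun v => (g (lift v.2)).toVec
      + (v.1 - (lift v.2).time) • (g (origin n)).toVec) fun v => by
    refine ((hvec (lift v.2)).add ((hvec (origin n)).const_smul
      (v.1 - (lift v.2).time))).congr fun i => ?_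
    rw [← map_smul, ← map_add, ← eq_toVec_add_smul_origin]
  refine ⟨B, hB, fun p => ?_⟩
  rw [hBf]
  change _ = (g (lift p.space)).toVec + (p.time - (lift p.space).time) • _
  rw [lift_space, sub_self, zero_smul, add_zero]

theorem theorem3p2 (n : ℕ) :
    (∀ (δ : InvariantDist (euclideanMotions n) (0 : EuclideanSpace ℝ (Fin n)))
        (K : Set (EuclideanSpace ℝ (Fin n))), IsBody K →
      ∃ μ : Measure (PackingSpace δ K), PackingSpace.IsOptimallyDense μ) ∧
    (∀ (δ : InvariantDist (hyperbolicMotions n) (HyperbolicSpace.origin n))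
        (K : Set (HyperbolicSpace n)), IsBody K →
      ∃ μ : Measure (PackingSpace δ K), PackingSpace.IsOptimallyDense μ) :=
  ⟨fun δ _ hK => PackingSpace.exists_isOptimallyDense (isPointwiseClosed_euclideanMotions n) δ hK,
    fun δ _ hK =>
      PackingSpace.exists_isOptimallyDense (isPointwiseClosed_hyperbolicMotions n) δ hK⟩

end
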